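/- Let $R$ be a Cohen–Macaulay local ring (commutative, Noetherian) and let $I\subset R$ be a perfect ideal, i.e. $I$ is a proper ideal with $\operatorname{projdim}_R(R/I)=\operatorname{grade}(I)$. Set $g=\operatorname{grade}(I)$, let $\mathbf y=(y_1,\dots,y_l)$ be any finite system of generators of $I$ (not necessarily minimal), and let $M$ be a maximal Cohen–Macaulay $R$-module, i.e. a nonzero finitely generated $R$-module with $\operatorname{depth}M=\dim R$. For $i\in\mathbb Z$ let $H_i(\mathbf y,M)$ be the $i$-th homology of the Koszul complex of $\mathbf y$ with coefficients in $M$ (so $H_i(\mathbf y,M)=0$ for $i<0$), and put $H_1(\mathbf y)=H_1(\mathbf y,R)$. Then there is an isomorphism of $R$-modules $$H_{l-g-1}(\mathbf y,M)\;\cong\;\operatorname{Ext}^g_R\bigl(H_1(\mathbf y),M\bigr).$$ In particular $N=H_{l-g-1}(\mathbf y,M)$ satisfies Serre's condition $S_2$, in both customary forms: $\operatorname{depth}N_{\mathfrak p}\ge\min\{2,\dim N_{\mathfrak p}\}$ for every prime $\mathfrak p$ of $R$, and, as a module over $A=R/I$, $\operatorname{depth}N_{\mathfrak p}\ge\min\{2,\dim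 A_{\mathfrak p}\}$ for every prime $\mathfrak p\supseteq I$. (The zero module has depth $\infty$.) -/

import Mathlib

open CategoryTheory

universe u

noncomputable section

namespace KoszulHom

section Koszul

variable {R : Type u} [CommRing R] {l : ℕ} (y : Fin l → R)
  (M : Type u) [AddCommGroup M] [Module R M]

/-- The degree `n` part `K_n(y, M)` of the Koszul complex, in coordinates: it is the direct sum of
copies of `M` indexed by the basis elements `e_s = e_{s₁} ∧ ⋯ ∧ e_{sₙ}` of the exterior power
`⋀ⁿ R^l`, where `s = {s₁ < ⋯ < sₙ}` runs over the `n`-element subsets of `{1, …, l}`.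
The degree `n` is an integer, and the module is zero for `n < 0` and for `n > l`. -/
abbrev KoszulModule (l : ℕ) (M : Type u) (n : ℤ) : Type u :=
  {s : Finset (Fin l) // (s.card : ℤ) = n} → M

/-- The Koszul differential `K_i(y, M) → K_j(y, M)` (zero unless `i = j + 1`). It is
`e_s ⊗ m ↦ ∑_{k ∈ s} (-1)^{#{a ∈ s | a < k}} y_k e_{s \ {k}} ⊗ m`, so that the coordinate at `e_t`
of the image of `f` is `∑_{k ∉ t} (-1)^{#{a ∈ t | a < k}} y_k f(e_{t ∪ {k}})`. -/
def koszulD (i j : ℤ) : KoszulModule l M i →ₗ[R] KoszulModule l M j where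
  toFun f t := ∑ k : Fin l,
    if h : k ∉ t.1 ∧ ((insert k t.1).card : ℤ) = i then
      ((-1 : R) ^ (t.1.filter (· < k)).card * y k) • f ⟨insert k t.1, h.2⟩
    else 0
  map_add' f g := by
    ext t
    rw [Pi.add_apply, ← Finset.sum_add_distrib]
    refine Finset.sum_congr rfl fun k _ => ?_
    split_ifs <;> simp
  map_smul' r f := by
    ext t
    rw [RingHom.id_apply, Pi.smul_apply, Finset.smul_sum]
    refine Finset.sum_congr rfl fun k _ => ?_
    split_ifs
    · simp only [Pi.smul_apply]
      rw [smul_comm]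
    · simp

theorem koszulD_apply (i j : ℤ) (f : KoszulModule l M i)
    (t : {s : Finset (Fin l) // (s.card : ℤ) = j}) :
    koszulD y M i j f t = ∑ k : Fin l,
      if h : k ∉ t.1 ∧ ((insert k t.1).card : ℤ) = i then
        ((-1 : R) ^ (t.1.filter (· < k)).card * y k) • f ⟨insert k t.1, h.2⟩
      else 0 := rfl

theorem koszulD_eq_zero (i j : ℤ) (hij : j + 1 ≠ i) : koszulD y M i j = 0 := by
  refine LinearMap.ext fun f => funext fun t => ?_
  rw [koszulD_apply]
  refine Finset.sum_eq_zero fun k _ => dif_neg ?_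
  rintro ⟨hk, hc⟩
  rw [Finset.card_insert_of_notMem hk] at hc
  have := t.2
  push_cast at hc
  omega

theorem koszul_sign {t : Finset (Fin l)} {k m : Fin l} (hk : k ∉ t) (hkm : k < m) :
    ((-1 : R) ^ (t.filter (· < k)).card * (-1) ^ ((insert k t).filter (· < m)).card) +
      (-1 : R) ^ (t.filter (· < m)).card * (-1) ^ ((insert m t).filter (· < k)).card = 0 := by
  have h1 : ((insert k t).filter (· < m)).card = (t.filter (· < m)).card + 1 := by
    rw [Finset.filter_insert, if_pos hkm, Finset.card_insert_of_notMem]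
    simp [hk]
  have h2 : (insert m t).filter (· < k) = t.filter (· < k) := by
    rw [Finset.filter_insert, if_neg (not_lt.mpr hkm.le)]
  rw [h1, h2]
  ring

theorem koszulD_comp (i j k : ℤ) : koszulD y M j k ∘ₗ koszulD y M i j = 0 := by
  classical
  refine LinearMap.ext fun f => funext fun t => ?_
  let F : Fin l × Fin l → M := fun q =>
    if h : (q.1 ∉ t.1 ∧ ((insert q.1 t.1).card : ℤ) = j) ∧
        q.2 ∉ insert q.1 t.1 ∧ ((insert q.2 (insert q.1 t.1)).card : ℤ) = i then
      (((-1 : R) ^ (t.1.filter (· < q.1)).card * (-1) ^ ((insert q.1 t.1).filter (· < q.2)).card)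
        * (y q.1 * y q.2)) • f ⟨insert q.2 (insert q.1 t.1), h.2.2⟩
    else 0
  have hF : (koszulD y M j k ∘ₗ koszulD y M i j) f t = ∑ q : Fin l × Fin l, F q := by
    rw [LinearMap.comp_apply, koszulD_apply, Fintype.sum_prod_type]
    refine Finset.sum_congr rfl fun a _ => ?_
    by_cases ha : a ∉ t.1 ∧ ((insert a t.1).card : ℤ) = j
    · rw [dif_pos ha, koszulD_apply, Finset.smul_sum]
      refine Finset.sum_congr rfl fun b _ => ?_
      by_cases hb : b ∉ insert a t.1 ∧ ((insert b (insert a t.1)).card : ℤ) = i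
      · simp only [F]
        rw [dif_pos hb, dif_pos ⟨ha, hb⟩, smul_smul]
        congr 1
        ring
      · simp only [F]
        rw [dif_neg hb, dif_neg (fun h => hb h.2), smul_zero]
    · rw [dif_neg ha]
      symm
      refine Finset.sum_eq_zero fun b _ => dif_neg (fun h => ha h.1)
  rw [hF, LinearMap.zero_apply, Pi.zero_apply]
  refine Finset.sum_involution (fun q _ => (q.2, q.1)) ?_ ?_ (fun _ _ => Finset.mem_univ _)
    (fun _ _ => rfl)
  · rintro ⟨a, b⟩ -
    simp only [F]
    by_cases h : (a ∉ t.1 ∧ ((insert a t.1).card : ℤ) = j) ∧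
        b ∉ insert a t.1 ∧ ((insert b (insert a t.1)).card : ℤ) = i
    · obtain ⟨⟨ha, haj⟩, hb, hbi⟩ := h
      have hb' : b ∉ t.1 := fun h => hb (Finset.mem_insert_of_mem h)
      have hab : b ≠ a := fun h => hb (h ▸ Finset.mem_insert_self _ _)
      have ha' : a ∉ insert b t.1 := by simp [ha, hab.symm]
      have hbj : ((insert b t.1).card : ℤ) = j := by
        rw [← haj, Finset.card_insert_of_notMem ha, Finset.card_insert_of_notMem hb']
      have hai : ((insert a (insert b t.1)).card : ℤ) = i := by
        rw [Finset.insert_comm, hbi]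
      rw [dif_pos ⟨⟨ha, haj⟩, hb, hbi⟩, dif_pos ⟨⟨hb', hbj⟩, ha', hai⟩]
      have he : (⟨insert a (insert b t.1), hai⟩ : {s : Finset (Fin l) // (s.card : ℤ) = i}) =
          ⟨insert b (insert a t.1), hbi⟩ := Subtype.ext (Finset.insert_comm _ _ _)
      rw [he, mul_comm (y b) (y a), ← add_smul, ← add_mul]
      rcases lt_or_gt_of_ne hab with hlt | hlt
      · rw [add_comm, koszul_sign hb' hlt, zero_mul, zero_smul]
      · rw [koszul_sign ha hlt, zero_mul, zero_smul]
    · rw [dif_neg h, dif_neg, add_zero]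
      rintro ⟨⟨hb, hbj⟩, ha, hai⟩
      apply h
      have ha' : a ∉ t.1 := fun h => ha (Finset.mem_insert_of_mem h)
      have hab : a ≠ b := fun h => ha (h ▸ Finset.mem_insert_self _ _)
      refine ⟨⟨ha', ?_⟩, by simp [hb, hab.symm], by rw [Finset.insert_comm, hai]⟩
      rw [← hbj, Finset.card_insert_of_notMem ha', Finset.card_insert_of_notMem hb]
  · rintro ⟨a, b⟩ - hne heq
    apply hne
    have hab : b = a := congrArg Prod.fst heq
    subst hab
    simp [F]

/-- The Koszul complex `K_•(y, M)`. -/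
def koszulComplex : ChainComplex (ModuleCat.{u} R) ℤ where
  X n := ModuleCat.of R (KoszulModule l M n)
  d i j := ModuleCat.ofHom (koszulD y M i j)
  shape i j hij := by
    rw [koszulD_eq_zero y M i j hij]
    rfl
  d_comp_d' i j k _ _ := by
    rw [← ModuleCat.ofHom_comp, koszulD_comp]
    rfl

/-- The Koszul homology `H_i(y, M)`; it vanishes for `i < 0`. -/
abbrev koszulHomology (i : ℤ) : ModuleCat.{u} R :=
  (koszulComplex y M).homology i

end Koszul

section Depth

/-- The grade of `I` on `M`: the supremum of the lengths of `M`-regular sequences in `I`.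
For a finitely generated `M` over a Noetherian ring with `I M = M` the value is `∞`, as is
customary, and for `I M ≠ M` every weakly `M`-regular sequence in `I` is `M`-regular. -/
def gradeOn {R : Type*} [CommRing R] (I : Ideal R) (M : Type*) [AddCommGroup M] [Module R M] : ℕ∞ :=
  ⨆ (rs : List R) (_ : (∀ r ∈ rs, r ∈ I) ∧ RingTheory.Sequence.IsWeaklyRegular M rs),
    (rs.length : ℕ∞)

/-- The depth of a module over a local ring (it is `∞` for the zero module). -/
def depth (R : Type*) [CommRing R] [IsLocalRing R] (M : Type*) [AddCommGroup M] [Module R M] :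
    ℕ∞ :=
  gradeOn (IsLocalRing.maximalIdeal R) M

/-- A Cohen–Macaulay local ring: Noetherian with depth equal to the Krull dimension. -/
structure IsCohenMacaulayLocal (R : Type*) [CommRing R] [IsLocalRing R] : Prop where
  isNoetherianRing : IsNoetherianRing R
  depth_eq : (depth R R : WithBot ℕ∞) = ringKrullDim R

/-- A maximal Cohen–Macaulay module: nonzero, finitely generated, of depth `dim R`. -/
structure IsMaximalCohenMacaulay (R : Type*) [CommRing R] [IsLocalRing R]
    (M : Type*) [AddCommGroup M] [Module R M] : Prop where
  finite : Module.Finite R M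
  nontrivial : Nontrivial M
  depth_eq : (depth R M : WithBot ℕ∞) = ringKrullDim R

/-- A perfect ideal: the projective dimension of `R ⧸ I` equals the grade of `I`. For `I = R` the
left-hand side is `-∞` and the right-hand side is `∞`, so perfect ideals are proper. -/
def IsPerfectIdeal {R : Type u} [CommRing R] (I : Ideal R) : Prop :=
  projectiveDimension (ModuleCat.of R (R ⧸ I)) = (gradeOn I R : WithBot ℕ∞)

/-- The depth of the localization of `N` at `p`, over the local ring `R_p`. -/
def depthAt {R : Type*} [CommRing R] (p : PrimeSpectrum R)
    (N : Type*) [AddCommGroup N] [Module R N] : ℕ∞ :=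
  depth (Localization.AtPrime p.asIdeal) (LocalizedModule p.asIdeal.primeCompl N)

/-- Serre's condition `S_k` for an `R`-module `N`: `depth N_p ≥ min (k, dim N_p)` for all `p`. -/
def SerreCondition (R : Type*) [CommRing R] (k : ℕ)
    (N : Type*) [AddCommGroup N] [Module R N] : Prop :=
  ∀ p : PrimeSpectrum R,
    min (k : WithBot ℕ∞)
        (Module.supportDim (Localization.AtPrime p.asIdeal)
          (LocalizedModule p.asIdeal.primeCompl N)) ≤
      (depthAt p N : WithBot ℕ∞)

/-- The other customary form of Serre's condition `S_k`, for a module `N` over `A = R ⧸ I`: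
`depth N_p ≥ min (k, dim A_p)` for all primes `p` containing `I`. Here `A_p = R_p ⧸ I R_p`, and
the depth of `N_p` is the same over `R_p` and over `A_p`. -/
def SerreConditionOver {R : Type*} [CommRing R] (I : Ideal R) (k : ℕ)
    (N : Type*) [AddCommGroup N] [Module R N] : Prop :=
  ∀ p : PrimeSpectrum R, I ≤ p.asIdeal →
    min (k : WithBot ℕ∞)
        (ringKrullDim (Localization.AtPrime p.asIdeal ⧸
          I.map (algebraMap R (Localization.AtPrime p.asIdeal)))) ≤
      (depthAt p N : WithBot ℕ∞)

end Depth

end KoszulHom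

end

/-! Write `K` for the Koszul complex of `y` over `R`, `H_j` for its homology and `C_j` for the
cokernel of `K_{j+1} → K_j`, so that `C_0 = R/I`. Self-duality of `K` identifies `H_{l-g-1}(y, M)`
with the cohomology of `Hom(K, M)` in degree `g + 1` (`nonempty_koszulHomology_linearEquiv_dual`).

Every `H_j` is killed by `I`, and `M`, being maximal Cohen–Macaulay, has a regular sequence of
length `g` in `I`; hence `Ext^n(H_j, M) = 0` for `n < g`. So below degree `g` the complex `K`
behaves like a free resolution. For `g > 0`, the sequences `H_j → C_j → im d` and `im d → K_{j-1} →
C_{j-1}` give `H^{g+1}(Hom(K, M)) ≅ Ext^1(C_g, M) ≅ ⋯ ≅ Ext^g(C_1, M)`. Perfection enters in the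
last step: `Ext^{g+1}` and `Ext^{g+2}` of `C_0 = R/I` vanish, so `Ext^g(C_1, M) ≅ Ext^g(H_1, M)`.
This is assembled in `nonempty_koszulHomology_linearEquiv_ext`; grade zero is treated directly.

For `S_2`, let `rs` be the `M`-regular sequence of length `g` in `I`. Then `Ext^g(H_1, M) ≅ Hom(H_1,
M/(rs)M)`, and regular sequences of length at most two pass from a module to `Hom` into it
(`isWeaklyRegular_ext`). In a prime `p ⊇ I`, `rs` extends to an `M`-regular sequence of length up to
the height of `p`, which is at least `g + dim A_p`. -/

namespace KoszulHom

/-! ### Linear isomorphisms from long exact `Ext` sequences; regular sequences and `Ext`. -/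

section ExtLinear

open Abelian

variable {R : Type u} [CommRing R] {S : ShortComplex (ModuleCat.{u} R)} (hS : S.ShortExact)
  (Y : ModuleCat.{u} R)

include hS

/-- This and the next two are the basic moves of the dimension shift: two neighbouring vanishing
terms of the contravariant sequence make the map between the others bijective. -/
theorem nonempty_ext_linearEquiv_of_subsingleton_X₃ (n : ℕ)
    [Subsingleton (Ext S.X₃ Y n)] [Subsingleton (Ext S.X₃ Y (n + 1))] :
    Nonempty (Ext S.X₂ Y n ≃ₗ[R] Ext S.X₁ Y n) := by
  refine ⟨LinearEquiv.ofBijective ((Ext.mk₀ S.f).precompOfLinear R Y (zero_add n)) ⟨?_, ?_⟩⟩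
  · rw [injective_iff_map_eq_zero]
    intro x hx
    obtain ⟨z, rfl⟩ := Ext.contravariant_sequence_exact₂ hS Y x hx
    rw [Subsingleton.elim z 0, Ext.comp_zero]
  · intro x
    exact Ext.contravariant_sequence_exact₁ hS Y x (add_comm 1 n) (Subsingleton.elim _ _)

theorem nonempty_ext_linearEquiv_of_subsingleton_X₁ (n : ℕ)
    [Subsingleton (Ext S.X₁ Y n)] [Subsingleton (Ext S.X₁ Y (n + 1))] :
    Nonempty (Ext S.X₃ Y (n + 1) ≃ₗ[R] Ext S.X₂ Y (n + 1)) := by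
  refine ⟨LinearEquiv.ofBijective ((Ext.mk₀ S.g).precompOfLinear R Y (zero_add (n + 1))) ⟨?_, ?_⟩⟩
  · rw [injective_iff_map_eq_zero]
    intro x hx
    obtain ⟨z, rfl⟩ := Ext.contravariant_sequence_exact₃ hS Y x hx (add_comm 1 n)
    rw [Subsingleton.elim z 0, Ext.comp_zero]
  · intro x
    exact Ext.contravariant_sequence_exact₂ hS Y x (Subsingleton.elim _ _)

theorem nonempty_ext_linearEquiv_of_subsingleton_X₂ (n : ℕ)
    [Subsingleton (Ext S.X₂ Y n)] [Subsingleton (Ext S.X₂ Y (n + 1))] :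
    Nonempty (Ext S.X₁ Y n ≃ₗ[R] Ext S.X₃ Y (n + 1)) := by
  refine ⟨LinearEquiv.ofBijective (hS.extClass.precompOfLinear R Y (add_comm 1 n)) ⟨?_, ?_⟩⟩
  · rw [injective_iff_map_eq_zero]
    intro x hx
    obtain ⟨z, rfl⟩ := Ext.contravariant_sequence_exact₁ hS Y x (add_comm 1 n) hx
    rw [Subsingleton.elim z 0, Ext.comp_zero]
  · intro x
    exact Ext.contravariant_sequence_exact₃ hS Y x (Subsingleton.elim _ _) (add_comm 1 n)

theorem nonempty_ext_linearEquiv_of_subsingleton_covariant (X : ModuleCat.{u} R) (n : ℕ)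
    [Subsingleton (Ext X S.X₂ n)] (h : ∀ z : Ext X S.X₁ (n + 1),
      z.comp (Ext.mk₀ S.f) (add_zero (n + 1)) = 0) :
    Nonempty (Ext X S.X₃ n ≃ₗ[R] Ext X S.X₁ (n + 1)) := by
  refine ⟨LinearEquiv.ofBijective (hS.extClass.postcompOfLinear R X rfl) ⟨?_, ?_⟩⟩
  · rw [injective_iff_map_eq_zero]
    intro x hx
    obtain ⟨z, rfl⟩ := Ext.covariant_sequence_exact₃ X hS x rfl hx
    rw [Subsingleton.elim z 0, Ext.zero_comp]
  · intro x
    exact Ext.covariant_sequence_exact₁ X hS x (h x) rfl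

omit hS

/-- An element annihilating `N` annihilates `Ext N Y n`. -/
theorem ext_smul_eq_zero_of_mem_annihilator {N : ModuleCat.{u} R} {r : R}
    (hr : r ∈ Module.annihilator R N) {n : ℕ} (z : Ext N Y n) : r • z = 0 := by
  have h : r • 𝟙 N = 0 := by
    ext x
    exact Module.mem_annihilator.mp hr x
  calc r • z = r • (Ext.mk₀ (𝟙 N)).comp z (zero_add n) := by rw [Ext.mk₀_id_comp]
    _ = (Ext.mk₀ (r • 𝟙 N)).comp z (zero_add n) := by rw [Ext.mk₀_smul, Ext.smul_comp]
    _ = 0 := by rw [h, Ext.mk₀_zero, Ext.zero_comp]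

/-- In the covariant sequence of `M → M → M/rM` multiplication by `r` is zero on `Ext N M (n + 1)`,
because `r` kills `N`; so the connecting map is onto, and it is injective since `Ext N M n`
vanishes. -/
theorem nonempty_ext_linearEquiv_quotSMulTop {N M : ModuleCat.{u} R} {r : R}
    (hr : r ∈ Module.annihilator R N) (hM : IsSMulRegular M r) (n : ℕ)
    [Subsingleton (Ext N M n)] :
    Nonempty (Ext N (ModuleCat.of R (QuotSMulTop r M)) n ≃ₗ[R] Ext N M (n + 1)) := by
  have : Subsingleton (Ext N (M.smulShortComplex r).X₂ n) := ‹_›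
  refine nonempty_ext_linearEquiv_of_subsingleton_covariant hM.smulShortComplex_shortExact N n
    fun z => ?_
  rw [ModuleCat.smulShortComplex_f_eq_smul_id]
  exact (Ext.smul_eq_comp_mk₀ z r).symm.trans (ext_smul_eq_zero_of_mem_annihilator _ hr z)

/-- `Ext` in degree zero is `Hom`, linearly. -/
noncomputable def extZeroLinearEquiv (N M : ModuleCat.{u} R) : Ext N M 0 ≃ₗ[R] (N →ₗ[R] M) :=
  Ext.linearEquiv₀.trans ModuleCat.homLinearEquiv

open RingTheory.Sequence Pointwise

/-- Vanishing of `Ext` below the length of a regular sequence in the annihilator. -/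
theorem subsingleton_ext_of_isWeaklyRegular {N : ModuleCat.{u} R} (rs : List R) (n : ℕ)
    (hn : n < rs.length) (M : ModuleCat.{u} R)
    (hrs : ∀ r ∈ rs, r ∈ Module.annihilator R N) (hM : IsWeaklyRegular M rs) :
    Subsingleton (Ext N M n) := by
  induction rs generalizing M n with
  | nil => simp at hn
  | cons r rs ih =>
    rw [isWeaklyRegular_cons_iff] at hM
    have hr : r ∈ Module.annihilator R N := hrs r List.mem_cons_self
    have h0 : Subsingleton (N →ₗ[R] M) := hM.1.linearMap_subsingleton_of_mem_annihilator hr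
    induction n with
    | zero => exact (extZeroLinearEquiv N M).injective.subsingleton
    | succ n ihn =>
      -- Vanishing in degree `n` permits the shift to `M/rM`, where the shorter sequence `rs` takes
      -- care of degree `n`.
      have := ihn (by omega)
      obtain ⟨e⟩ := nonempty_ext_linearEquiv_quotSMulTop hr hM.1 n
      have := ih n (by simpa using hn) (ModuleCat.of R (QuotSMulTop r M))
        (fun s hs => hrs s (List.mem_cons_of_mem _ hs)) hM.2
      exact e.symm.injective.subsingleton

/-- A weakly regular sequence of length at most two on `M` is weakly regular on `Hom(N, M)`. -/
theorem isWeaklyRegular_linearMap (N M : Type*) [AddCommGroup N] [Module R N] [AddCommGroup M]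
    [Module R M] (us : List R) (hus : us.length ≤ 2) (hM : IsWeaklyRegular M us) :
    IsWeaklyRegular (N →ₗ[R] M) us := by
  have key : ∀ (P : Type _) [AddCommGroup P] [Module R P] {a : R}, IsSMulRegular P a →
      IsSMulRegular (N →ₗ[R] P) a := fun P _ _ a ha f f' hf => by
    ext x
    exact ha (LinearMap.congr_fun hf x)
  match us, hus with
  | [], _ => exact IsWeaklyRegular.nil _ _
  | [a], _ =>
    rw [isWeaklyRegular_singleton_iff] at hM ⊢
    exact key _ hM
  | [a, b], _ =>
    rw [isWeaklyRegular_cons_iff, isWeaklyRegular_singleton_iff] at hM ⊢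
    refine ⟨key _ hM.1, ?_⟩
    rw [isSMulRegular_iff_right_eq_zero_of_smul]
    intro x hx
    obtain ⟨f, rfl⟩ := Submodule.mkQ_surjective _ x
    have hx' : b • f ∈ a • (⊤ : Submodule R (N →ₗ[R] M)) := by
      rwa [← map_smul, Submodule.mkQ_apply, Submodule.Quotient.mk_eq_zero] at hx
    obtain ⟨h, -, hh⟩ := (Submodule.mem_smul_pointwise_iff_exists _ _ _).mp hx'
    -- Left exactness of `Hom` at work: regularity of `b` on `M/aM` makes every value of `f`
    -- divisible by `a`, and regularity of `a` on `M` makes the pointwise quotients `w` linear.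
    have hf : ∀ z, f z ∈ a • (⊤ : Submodule R M) := by
      intro z
      have hb : b • (Submodule.Quotient.mk (f z) : QuotSMulTop a M) = 0 := by
        rw [← Submodule.Quotient.mk_smul, Submodule.Quotient.mk_eq_zero]
        exact (Submodule.mem_smul_pointwise_iff_exists _ _ _).mpr
          ⟨h z, trivial, LinearMap.congr_fun hh z⟩
      have := hM.2.right_eq_zero_of_smul hb
      rwa [Submodule.Quotient.mk_eq_zero] at this
    have hf' : ∀ z, ∃ w, a • w = f z := fun z => by
      obtain ⟨w, -, hw⟩ := (Submodule.mem_smul_pointwise_iff_exists _ _ _).mp (hf z)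
      exact ⟨w, hw⟩
    choose w hw using hf'
    rw [Submodule.mkQ_apply, Submodule.Quotient.mk_eq_zero]
    refine (Submodule.mem_smul_pointwise_iff_exists _ _ _).mpr
      ⟨⟨⟨w, fun z z' => hM.1 ?_⟩, fun r z => hM.1 ?_⟩, trivial, LinearMap.ext hw⟩
    · simp only [hw, smul_add, map_add]
    · simp only [hw, map_smul, RingHom.id_apply]
      rw [smul_comm, hw]

/-- If `rs ++ us` is weakly regular on `M`, where `rs` annihilates `N` and `us` has length at most
two, then `us` is weakly regular on `Ext N M rs.length`. -/
theorem isWeaklyRegular_ext {N : ModuleCat.{u} R} (rs us : List R) (hus : us.length ≤ 2)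
    (M : ModuleCat.{u} R) (hrs : ∀ r ∈ rs, r ∈ Module.annihilator R N)
    (hM : IsWeaklyRegular M (rs ++ us)) : IsWeaklyRegular (Ext N M rs.length) us := by
  induction rs generalizing M with
  | nil =>
    exact ((extZeroLinearEquiv N M).isWeaklyRegular_congr us).mpr
      (isWeaklyRegular_linearMap N M us hus hM)
  | cons r rs ih =>
    have hrs' : IsWeaklyRegular M (r :: rs) :=
      ((isWeaklyRegular_append_iff M (r :: rs) us).mp hM).1
    -- The degree just below the length of `r :: rs` vanishes, so `r` can be traded for one degree
    -- of `Ext`.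
    have := subsingleton_ext_of_isWeaklyRegular (r :: rs) rs.length (by simp) M hrs hrs'
    rw [List.cons_append, isWeaklyRegular_cons_iff] at hM
    obtain ⟨e⟩ := nonempty_ext_linearEquiv_quotSMulTop (hrs r List.mem_cons_self) hM.1 rs.length
    exact (e.isWeaklyRegular_congr us).mp (ih (ModuleCat.of R (QuotSMulTop r M))
      (fun s hs => hrs s (List.mem_cons_of_mem _ hs)) hM.2)

end ExtLinear

/-! ### The null-homotopy given by exterior multiplication. -/

section Homotopy

variable {R : Type u} [CommRing R] {l : ℕ} (y : Fin l → R)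
  (M : Type u) [AddCommGroup M] [Module R M]

theorem neg_one_pow_mul_self (n : ℕ) : (-1 : R) ^ n * (-1) ^ n = 1 := by
  rw [← mul_pow]; simp

/-- Exterior multiplication by `e_k` on the Koszul complex. -/
def koszulWedge (k : Fin l) {i j : ℤ} (hij : i + 1 = j) (f : KoszulModule l M i) :
    KoszulModule l M j := fun s =>
  if h : k ∈ s.1 then
    ((-1 : R) ^ ((s.1.erase k).filter (· < k)).card) • f ⟨s.1.erase k, by
      have := Finset.card_erase_add_one h
      have := s.2
      omega⟩
  else 0

theorem koszulWedge_apply (k : Fin l) {i j : ℤ} (hij : i + 1 = j) (f : KoszulModule l M i)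
    (s : Finset (Fin l)) (hs : (s.card : ℤ) = j) (h : k ∈ s) (hs' : ((s.erase k).card : ℤ) = i) :
    koszulWedge (R := R) M k hij f ⟨s, hs⟩ =
      ((-1 : R) ^ ((s.erase k).filter (· < k)).card) • f ⟨s.erase k, hs'⟩ :=
  dif_pos h

theorem koszulD_apply_succ {i j : ℤ} (hij : j + 1 = i) (f : KoszulModule l M i)
    (t : {s : Finset (Fin l) // (s.card : ℤ) = j}) :
    koszulD y M i j f t = ∑ k : Fin l,
      if h : k ∉ t.1 then
        ((-1 : R) ^ (t.1.filter (· < k)).card * y k) • f ⟨insert k t.1, by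
          rw [Finset.card_insert_of_notMem h]; have := t.2; omega⟩
      else 0 := by
  rw [koszulD_apply]
  refine Finset.sum_congr rfl fun k _ => ?_
  by_cases h : k ∉ t.1
  · rw [dif_pos h, dif_pos ⟨h, by rw [Finset.card_insert_of_notMem h]; have := t.2; omega⟩]
  · rw [dif_neg h, dif_neg (fun h' => h h'.1)]

/-- Multiplication by `y k` is null-homotopic on the Koszul complex. -/
theorem koszulD_koszulWedge_add (k : Fin l) {a b c : ℤ} (hab : b + 1 = a) (hbc : c + 1 = b)
    (f : KoszulModule l M b) :
    koszulD y M a b (koszulWedge (R := R) M k hab f) +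
      koszulWedge (R := R) M k hbc (koszulD y M b c f) = y k • f := by
  funext ⟨t, ht⟩
  rw [Pi.add_apply, Pi.smul_apply, koszulD_apply_succ y M hab]
  -- If `k ∈ t`, the summands with `m ≠ k` cancel between the two terms by anticommutation, and `m =
  -- k` survives only in the second. If `k ∉ t`, the second term is zero and only `m = k` survives
  -- in the first.
  by_cases hk : k ∈ t
  · have hc : ((t.erase k).card : ℤ) = c := by
      have := Finset.card_erase_add_one hk
      omega
    rw [koszulWedge_apply M k hbc _ t ht hk hc, koszulD_apply_succ y M hbc, Finset.smul_sum,
      ← Finset.sum_add_distrib, Finset.sum_eq_single k]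
    · rw [dif_neg (by simpa using hk), zero_add, dif_pos (Finset.notMem_erase k t), smul_smul,
        ← mul_assoc, neg_one_pow_mul_self, one_mul]
      congr 2
      exact Subtype.ext (Finset.insert_erase hk)
    · intro m _ hm
      by_cases hmt : m ∈ t
      · rw [dif_neg (by simpa using hmt), dif_neg (by simp [hm, hmt]), smul_zero, add_zero]
      · have hmt' : m ∉ t.erase k := fun h => hmt (Finset.mem_of_mem_erase h)
        have hcomm : (insert m t).erase k = insert m (t.erase k) :=
          Finset.erase_insert_of_ne hm
        rw [dif_pos hmt, dif_pos hmt', koszulWedge_apply M k hab f _ _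
          (Finset.mem_insert_of_mem hk) (by rw [hcomm, Finset.card_insert_of_notMem hmt']; omega)]
        have he : ∀ h, (⟨(insert m t).erase k, h⟩ : {s : Finset (Fin l) // (s.card : ℤ) = b}) =
          ⟨insert m (t.erase k), by rw [← hcomm]; exact h⟩ := fun h => Subtype.ext hcomm
        rw [he, smul_smul, smul_smul, ← add_smul]
        have hsign : (-1 : R) ^ (t.filter (· < m)).card *
            (-1) ^ ((insert m (t.erase k)).filter (· < k)).card +
            (-1) ^ ((t.erase k).filter (· < k)).card *
              (-1) ^ ((t.erase k).filter (· < m)).card = 0 := by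
          have hins : insert k (t.erase k) = t := Finset.insert_erase hk
          rcases lt_or_gt_of_ne hm with hlt | hlt
          · have h1 := koszul_sign (R := R) (t := t.erase k) hmt' hlt
            rw [hins] at h1
            have h2 : t.filter (· < m) = (t.erase k).filter (· < m) := by
              ext x
              simp only [Finset.mem_filter, Finset.mem_erase]
              constructor
              · rintro ⟨h, h'⟩
                exact ⟨⟨(h'.trans hlt).ne, h⟩, h'⟩
              · rintro ⟨⟨_, h⟩, h'⟩
                exact ⟨h, h'⟩
            rw [h2] at h1 ⊢
            linear_combination h1
          · have h1 := koszul_sign (R := R) (t := t.erase k) (Finset.notMem_erase k t) hlt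
            rw [hins] at h1
            have h2 : (insert m (t.erase k)).filter (· < k) = (t.erase k).filter (· < k) := by
              rw [Finset.filter_insert, if_neg (not_lt.mpr hlt.le)]
            have h3 : (t.filter (· < m)).card = ((t.erase k).filter (· < m)).card + 1 := by
              conv_lhs => rw [← hins, Finset.filter_insert, if_pos hlt]
              rw [Finset.card_insert_of_notMem (by simp)]
            rw [h2, h3]
            ring
        have hcoef : (-1 : R) ^ (t.filter (· < m)).card * y m *
            (-1) ^ (((insert m t).erase k).filter (· < k)).card +
            (-1) ^ ((t.erase k).filter (· < k)).card *
              ((-1) ^ ((t.erase k).filter (· < m)).card * y m) = 0 := by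
          rw [hcomm]
          linear_combination (y m) * hsign
        exact (congrArg (· • _) hcoef).trans (zero_smul R _)
    · intro h
      exact absurd (Finset.mem_univ k) h
  · have hw : koszulWedge (R := R) M k hbc (koszulD y M b c f) ⟨t, ht⟩ = 0 := dif_neg hk
    rw [hw, add_zero, Finset.sum_eq_single k]
    · rw [dif_pos hk, koszulWedge_apply M k hab f _ _ (Finset.mem_insert_self k t)
        (by rw [Finset.erase_insert hk]; exact ht), smul_smul]
      have he : ∀ h, (⟨(insert k t).erase k, h⟩ : {s : Finset (Fin l) // (s.card : ℤ) = b}) =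
          ⟨t, ht⟩ := fun h => Subtype.ext (Finset.erase_insert hk)
      rw [he, Finset.erase_insert hk]
      congr 1
      linear_combination (y k) * neg_one_pow_mul_self (R := R) (t.filter (· < k)).card
    · intro m _ hm
      by_cases hmt : m ∈ t
      · exact dif_neg (by simpa using hmt)
      · rw [dif_pos hmt]
        have : koszulWedge (R := R) M k hab f ⟨insert m t, by
            rw [Finset.card_insert_of_notMem hmt]; omega⟩ = 0 :=
          dif_neg (by simp [hk, hm.symm])
        rw [this, smul_zero]
    · intro h
      exact absurd (Finset.mem_univ k) h

end Homotopy

/-! ### Koszul homology as kernel modulo image, and its annihilator. -/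

section LinearHomology

variable {R : Type u} [CommRing R] {A B C : Type u} [AddCommGroup A] [Module R A]
  [AddCommGroup B] [Module R B] [AddCommGroup C] [Module R C]

/-- The homology of a pair of linear maps, as a quotient of the kernel. -/
abbrev linearHomology (f : A →ₗ[R] B) (e : B →ₗ[R] C) : Type u :=
  LinearMap.ker e ⧸ (LinearMap.range f).submoduleOf (LinearMap.ker e)

variable {l : ℕ} (y : Fin l → R) (M : Type u) [AddCommGroup M] [Module R M]

theorem nonempty_koszulHomology_linearEquiv {i j k : ℤ} (hij : j + 1 = i) (hjk : k + 1 = j) :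
    Nonempty (koszulHomology y M j ≃ₗ[R]
      linearHomology (koszulD y M i j) (koszulD y M j k)) := by
  have e1 := ShortComplex.homologyMapIso ((koszulComplex y M).isoSc' i j k
    (by subst hij; simp) (by subst hjk; simp))
  have e2 := ((koszulComplex y M).sc' i j k).moduleCatHomologyIso
  have e3 : (((koszulComplex y M).sc' i j k).moduleCatLeftHomologyData.H : Type u) ≃ₗ[R]
      linearHomology (koszulD y M i j) (koszulD y M j k) := by
    refine Submodule.quotEquivOfEq _ _ ?_
    ext x
    simp only [Submodule.submoduleOf, LinearMap.mem_range]
    constructor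
    · rintro ⟨z, rfl⟩
      exact ⟨z, rfl⟩
    · rintro ⟨z, hz⟩
      exact ⟨z, Subtype.ext hz⟩
  exact ⟨(e1.trans e2).toLinearEquiv.trans e3⟩

theorem mem_annihilator_linearHomology_koszulD {i j k : ℤ} (hij : j + 1 = i) (hjk : k + 1 = j)
    {r : R} (hr : r ∈ Ideal.span (Set.range y)) :
    r ∈ Module.annihilator R (linearHomology (koszulD y M i j) (koszulD y M j k)) := by
  refine Ideal.span_le.mpr ?_ hr
  rintro _ ⟨m, rfl⟩
  refine Module.mem_annihilator.mpr fun x => ?_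
  obtain ⟨⟨f, hf⟩, rfl⟩ := Submodule.mkQ_surjective _ x
  rw [← map_smul, Submodule.mkQ_apply, Submodule.Quotient.mk_eq_zero, Submodule.submoduleOf,
    Submodule.mem_comap]
  refine ⟨koszulWedge (R := R) M m hij f, ?_⟩
  have h := koszulD_koszulWedge_add y M m hij hjk f
  rw [LinearMap.mem_ker.mp hf] at h
  have h0 : koszulWedge (R := R) M m hjk (0 : KoszulModule l M k) = 0 := by
    funext s
    simp [koszulWedge]
  rw [h0, add_zero] at h
  exact h

theorem mem_annihilator_koszulHomology (j : ℤ) {r : R} (hr : r ∈ Ideal.span (Set.range y)) :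
    r ∈ Module.annihilator R (koszulHomology y M j) := by
  obtain ⟨e⟩ := nonempty_koszulHomology_linearEquiv y M (j := j) rfl (sub_add_cancel j 1)
  rw [e.annihilator_eq]
  exact mem_annihilator_linearHomology_koszulD y M rfl (sub_add_cancel j 1) hr

end LinearHomology

/-! ### Self-duality of the Koszul complex. -/

section Duality

variable {R : Type u} [CommRing R] {l : ℕ} (y : Fin l → R)
  (M : Type u) [AddCommGroup M] [Module R M]

/-- The bijection of `j`-element and `(l - j)`-element subsets given by the complement. -/
def complEquiv {a j : ℤ} (haj : a + j = l) :
    {s : Finset (Fin l) // (s.card : ℤ) = j} ≃ {s : Finset (Fin l) // (s.card : ℤ) = a} where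
  toFun s := ⟨s.1ᶜ, by
    have := s.1.card_add_card_compl; have := s.2; rw [Fintype.card_fin] at *; omega⟩
  invFun s := ⟨s.1ᶜ, by
    have := s.1.card_add_card_compl; have := s.2; rw [Fintype.card_fin] at *; omega⟩
  left_inv s := Subtype.ext (compl_compl s.1)
  right_inv s := Subtype.ext (compl_compl s.1)

/-- The sign of the self-duality of the Koszul complex. -/
def dualSign (R : Type u) [CommRing R] {l : ℕ} (s : Finset (Fin l)) : R :=
  (-1) ^ ∑ a ∈ s, (a : ℕ)

theorem dualSign_mul_self (s : Finset (Fin l)) : dualSign R s * dualSign R s = 1 :=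
  neg_one_pow_mul_self _

/-- Each of the `k` indices below `k` (counting from zero) lies either in `s` or in its complement,
so the two cardinalities add up to `k`, which is also the drop of `∑ a` on erasing `k`. -/
theorem dualSign_erase {s : Finset (Fin l)} {k : Fin l} (hk : k ∈ s) :
    dualSign R (s.erase k) * (-1) ^ ((s.erase k).filter (· < k)).card =
      dualSign R s * (-1) ^ (sᶜ.filter (· < k)).card := by
  have h1 : ∑ a ∈ s, (a : ℕ) = ∑ a ∈ s.erase k, (a : ℕ) + k :=
    (Finset.sum_erase_add _ _ hk).symm
  have h2 : ((s.erase k).filter (· < k)).card + (sᶜ.filter (· < k)).card = k := by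
    rw [← Finset.card_union_of_disjoint]
    · have : (s.erase k).filter (· < k) ∪ sᶜ.filter (· < k) = Finset.Iio k := by
        ext x
        simp only [Finset.mem_union, Finset.mem_filter, Finset.mem_erase, Finset.mem_compl,
          Finset.mem_Iio]
        have : x < k → x ≠ k := fun h => h.ne
        tauto
      rw [this, Fin.card_Iio]
    · refine Finset.disjoint_left.mpr fun x hx hx' => ?_
      simp only [Finset.mem_filter, Finset.mem_erase, Finset.mem_compl] at hx hx'
      exact hx'.1 hx.1.2
  have h3 : ((-1 : R)) ^ (k : ℕ) =
      (-1) ^ ((s.erase k).filter (· < k)).card * (-1) ^ (sᶜ.filter (· < k)).card := by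
    rw [← pow_add, h2]
  have h4 := neg_one_pow_mul_self (R := R) (sᶜ.filter (· < k)).card
  rw [dualSign, dualSign, h1, pow_add, h3]
  linear_combination (-(-1 : R) ^ (∑ a ∈ s.erase k, (a : ℕ)) *
    (-1) ^ ((s.erase k).filter (· < k)).card) * h4

/-- The self-duality `K_a(y, M) ≃ Hom(K_j(y, R), M)` for `a + j = l`. -/
noncomputable def koszulDual {a j : ℤ} (haj : a + j = l) :
    KoszulModule l M a ≃ₗ[R] (KoszulModule l R j →ₗ[R] M) :=
  ((LinearEquiv.funCongrLeft R M (complEquiv haj)).trans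
    (LinearEquiv.piCongrRight fun s => LinearEquiv.smulOfUnit
      (Units.mk (dualSign R s.1) (dualSign R s.1) (dualSign_mul_self s.1)
        (dualSign_mul_self s.1)))).trans
    ((Pi.basisFun R {s : Finset (Fin l) // (s.card : ℤ) = j}).constr R)

theorem koszulDual_single {a j : ℤ} (haj : a + j = l) (m : KoszulModule l M a)
    (s : {s : Finset (Fin l) // (s.card : ℤ) = j}) :
    koszulDual M haj m (Pi.single s (1 : R)) = dualSign R s.1 • m (complEquiv haj s) := by
  rw [← Pi.basisFun_apply R _ s]
  exact Module.Basis.constr_basis _ R _ s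

theorem koszulDual_apply {a j : ℤ} (haj : a + j = l) (m : KoszulModule l M a)
    (v : KoszulModule l R j) :
    koszulDual M haj m v = ∑ s, v s • dualSign R s.1 • m (complEquiv haj s) := by
  conv_lhs => rw [← (Pi.basisFun R _).sum_repr v]
  rw [map_sum]
  refine Finset.sum_congr rfl fun s _ => ?_
  rw [map_smul, Pi.basisFun_repr, Pi.basisFun_apply, koszulDual_single]

/-- The signs `dualSign` are chosen so that the duality commutes with the differentials with no
further sign. At the basis vector of `s`, both sides are sums over `q ∈ s`, where only the subset `s
\ {q}` contributes. -/
theorem koszulDual_koszulD {a b j k : ℤ} (hab : b + 1 = a) (hjk : k + 1 = j)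
    (hbj : b + j = l) (hak : a + k = l) (m : KoszulModule l M a) :
    koszulDual M hbj (koszulD y M a b m) = koszulDual M hak m ∘ₗ koszulD y R j k := by
  refine (Pi.basisFun R _).ext fun s => ?_
  rw [Pi.basisFun_apply, koszulDual_single, LinearMap.comp_apply, koszulDual_apply,
    koszulD_apply_succ y M hab, Finset.smul_sum]
  simp only [koszulD_apply_succ y R hjk, Finset.sum_smul]
  rw [Finset.sum_comm]
  refine Finset.sum_congr rfl fun q _ => ?_
  obtain ⟨s, hs⟩ := s
  by_cases hq : q ∈ s
  · have hq' : q ∉ sᶜ := by simpa using hq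
    have hse : ((s.erase q).card : ℤ) = k := by
      have := Finset.card_erase_add_one hq
      omega
    rw [Finset.sum_eq_single (⟨s.erase q, hse⟩ : {s : Finset (Fin l) // (s.card : ℤ) = k})]
    · have h1 : (insert q (s.erase q)) = s := Finset.insert_erase hq
      rw [dif_pos (show q ∉ (complEquiv hbj ⟨s, hs⟩).1 from hq'),
        dif_pos (show q ∉ s.erase q from Finset.notMem_erase q s)]
      have h2 : (⟨insert q (s.erase q), by rw [h1]; exact hs⟩ :
        {s : Finset (Fin l) // (s.card : ℤ) = j}) = ⟨s, hs⟩ := Subtype.ext h1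
      rw [h2, Pi.single_eq_same, smul_eq_mul, mul_one, smul_smul, smul_smul]
      have h3 : complEquiv hak ⟨s.erase q, hse⟩ = ⟨insert q sᶜ, by
          have := Finset.card_insert_of_notMem hq'
          have := s.card_add_card_compl
          rw [Fintype.card_fin] at *
          omega⟩ := Subtype.ext (Finset.compl_erase)
      rw [h3]
      congr 1
      have := dualSign_erase (R := R) hq
      change dualSign R s * ((-1) ^ (sᶜ.filter (· < q)).card * y q) =
        (-1) ^ ((s.erase q).filter (· < q)).card * y q * dualSign R (s.erase q)
      linear_combination (- y q) * this
    · rintro ⟨t, ht⟩ _ hne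
      by_cases hqt : q ∈ t
      · rw [dif_neg (by simpa using hqt), zero_smul]
      · rw [dif_pos hqt, Pi.single_eq_of_ne, smul_zero, zero_smul]
        intro h
        apply hne
        have h' : insert q t = s := congrArg Subtype.val h
        refine Subtype.ext ?_
        change t = s.erase q
        rw [← h', Finset.erase_insert hqt]
    · intro h
      exact absurd (Finset.mem_univ _) h
  · have hq' : q ∈ sᶜ := by simpa using hq
    rw [dif_neg (show ¬ q ∉ (complEquiv hbj ⟨s, hs⟩).1 from fun h => h hq'), smul_zero]
    symm
    refine Finset.sum_eq_zero ?_
    rintro ⟨t, ht⟩ _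
    by_cases hqt : q ∈ t
    · rw [dif_neg (by simpa using hqt), zero_smul]
    · rw [dif_pos hqt, Pi.single_eq_of_ne, smul_zero, zero_smul]
      intro h
      apply hq
      have h' : insert q t = s := congrArg Subtype.val h
      rw [← h']
      exact Finset.mem_insert_self q t

variable {A B C A' B' C' : Type u} [AddCommGroup A] [Module R A]
  [AddCommGroup B] [Module R B] [AddCommGroup C] [Module R C] [AddCommGroup A'] [Module R A']
  [AddCommGroup B'] [Module R B'] [AddCommGroup C'] [Module R C']

/-- Isomorphic pairs of maps have isomorphic homology. -/
theorem nonempty_linearHomology_congr {f : A →ₗ[R] B} {e : B →ₗ[R] C} {f' : A' →ₗ[R] B'}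
    {e' : B' →ₗ[R] C'} (a : A ≃ₗ[R] A') (b : B ≃ₗ[R] B') (c : C ≃ₗ[R] C')
    (hf : ∀ x, b (f x) = f' (a x)) (he : ∀ x, c (e x) = e' (b x)) :
    Nonempty (linearHomology f e ≃ₗ[R] linearHomology f' e') := by
  have hk : ∀ x, x ∈ LinearMap.ker e ↔ b x ∈ LinearMap.ker e' := fun x => by
    rw [LinearMap.mem_ker, LinearMap.mem_ker, ← he, map_eq_zero_iff c c.injective]
  let b' : LinearMap.ker e ≃ₗ[R] LinearMap.ker e' := b.ofSubmodules _ _ (by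
    ext x
    rw [Submodule.mem_map_equiv, hk, LinearEquiv.apply_symm_apply])
  refine ⟨Submodule.Quotient.equiv _ _ b' ?_⟩
  ext ⟨x, hx⟩
  rw [Submodule.mem_map_equiv]
  constructor
  · rintro ⟨z, hz⟩
    refine ⟨a z, ?_⟩
    rw [← hf, hz]
    exact b.apply_symm_apply x
  · rintro ⟨z, hz⟩
    refine ⟨a.symm z, b.injective ?_⟩
    rw [hf, a.apply_symm_apply, hz]
    exact (b.apply_symm_apply x).symm

/-- Koszul homology with coefficients is the cohomology of `Hom(K(y, R), M)`. -/
theorem nonempty_koszulHomology_linearEquiv_dual {a i j k : ℤ} (haj : a + j = l) (hij : j + 1 = i)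
    (hjk : k + 1 = j) :
    Nonempty (koszulHomology y M a ≃ₗ[R]
      linearHomology ((koszulD y R j k).lcomp R M) ((koszulD y R i j).lcomp R M)) := by
  obtain ⟨e⟩ := nonempty_koszulHomology_linearEquiv y M (j := a) rfl (sub_add_cancel a 1)
  obtain ⟨e'⟩ := nonempty_linearHomology_congr (f := koszulD y M (a + 1) a)
    (e := koszulD y M a (a - 1)) (f' := (koszulD y R j k).lcomp R M)
    (e' := (koszulD y R i j).lcomp R M)
    (koszulDual M (show a + 1 + k = l by omega)) (koszulDual M haj)
    (koszulDual M (show a - 1 + i = l by omega))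
    (fun x => koszulDual_koszulD y M rfl hjk haj _ x)
    (fun x => koszulDual_koszulD y M (sub_add_cancel a 1) hij _ haj x)
  exact ⟨e.trans e'⟩

/-- The cokernel of the Koszul differential into degree zero is `R ⧸ (y)`. -/
theorem nonempty_koszulModule_zero_quotient_linearEquiv (I : Ideal R)
    (hy : Ideal.span (Set.range y) = I) :
    Nonempty ((KoszulModule l R 0 ⧸ LinearMap.range (koszulD y R 1 0)) ≃ₗ[R] (R ⧸ I)) := by
  let U : Unique {s : Finset (Fin l) // (s.card : ℤ) = 0} :=
    { default := ⟨∅, by simp⟩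
      uniq := fun s => Subtype.ext (Finset.card_eq_zero.mp (by exact_mod_cast s.2)) }
  have hdef : (default : {s : Finset (Fin l) // (s.card : ℤ) = 0}) = ⟨∅, by simp⟩ := rfl
  have hval : ∀ f : KoszulModule l R 1, koszulD y R 1 0 f ⟨∅, by simp⟩ =
      ∑ k : Fin l, y k * f ⟨{k}, by simp⟩ := fun f => by
    rw [koszulD_apply_succ y R (by norm_num)]
    refine Finset.sum_congr rfl fun k _ => ?_
    rw [dif_pos (by simp)]
    exact congrArg₂ (· • ·) (by simp) (congrArg f (Subtype.ext (insert_empty_eq k)))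
  refine ⟨Submodule.Quotient.equiv _ _ (LinearEquiv.funUnique _ R R) ?_⟩
  ext x
  rw [← hy, Submodule.mem_map_equiv]
  constructor
  · rintro ⟨f, hf⟩
    have : x = koszulD y R 1 0 f ⟨∅, by simp⟩ := by rw [hf]; rfl
    rw [this, hval]
    exact Ideal.sum_mem _ fun k _ => Ideal.mul_mem_right _ _ (Ideal.subset_span ⟨k, rfl⟩)
  · intro hx
    obtain ⟨c, rfl⟩ := (Ideal.mem_span_range_iff_exists_fun).mp hx
    refine ⟨fun s => ∑ k, if s.1 = {k} then c k else 0, ?_⟩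
    funext s
    rw [Unique.eq_default s, hdef, hval]
    change _ = ∑ k, c k * y k
    refine Finset.sum_congr rfl fun k _ => ?_
    simp [mul_comm]

end Duality

/-! ### Dimension shifting along complexes that need not be exact. -/

section DimensionShift

open Abelian

variable {R : Type u} [CommRing R] {A B C : Type u} [AddCommGroup A] [Module R A]
  [AddCommGroup B] [Module R B] [AddCommGroup C] [Module R C]

/-- The short complex `S → C → C ⧸ S`. -/
abbrev submoduleShortComplex (S : Submodule R C) : ShortComplex (ModuleCat.{u} R) :=
  ModuleCat.shortComplexOfCompEqZero S.subtype S.mkQ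
    (LinearMap.exact_subtype_mkQ S).linearMap_comp_eq_zero

theorem submoduleShortComplex_shortExact (S : Submodule R C) :
    (submoduleShortComplex S).ShortExact :=
  ModuleCat.shortComplex_shortExact _ (LinearMap.exact_subtype_mkQ S) S.injective_subtype
    S.mkQ_surjective

/-- The inclusion of the homology into the cokernel. -/
def homologyToCoker (f : A →ₗ[R] B) (e : B →ₗ[R] C) :
    linearHomology f e →ₗ[R] (B ⧸ LinearMap.range f) :=
  Submodule.mapQ _ _ (LinearMap.ker e).subtype le_rfl

/-- The map from the cokernel onto the image of the next map. -/
def cokerToRange (f : A →ₗ[R] B) (e : B →ₗ[R] C) (h : e ∘ₗ f = 0) :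
    (B ⧸ LinearMap.range f) →ₗ[R] LinearMap.range e :=
  (LinearMap.range f).liftQ e.rangeRestrict (by
    rintro _ ⟨a, rfl⟩
    exact Subtype.ext (LinearMap.congr_fun h a))

theorem homologyToCoker_injective (f : A →ₗ[R] B) (e : B →ₗ[R] C) :
    Function.Injective (homologyToCoker f e) := by
  rw [injective_iff_map_eq_zero]
  intro x hx
  obtain ⟨x, rfl⟩ := Submodule.mkQ_surjective _ x
  exact (Submodule.Quotient.mk_eq_zero _).mpr
    ((Submodule.Quotient.mk_eq_zero (LinearMap.range f)).mp hx)

theorem cokerToRange_surjective (f : A →ₗ[R] B) (e : B →ₗ[R] C) (h : e ∘ₗ f = 0) :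
    Function.Surjective (cokerToRange f e h) := by
  rintro ⟨_, b, rfl⟩
  exact ⟨Submodule.Quotient.mk b, rfl⟩

theorem homologyToCoker_exact (f : A →ₗ[R] B) (e : B →ₗ[R] C) (h : e ∘ₗ f = 0) :
    Function.Exact (homologyToCoker f e) (cokerToRange f e h) := by
  intro x
  obtain ⟨b, rfl⟩ := Submodule.mkQ_surjective _ x
  constructor
  · intro hb
    exact ⟨Submodule.Quotient.mk ⟨b, congrArg Subtype.val hb⟩, rfl⟩
  · rintro ⟨z, hz⟩
    rw [← hz]
    obtain ⟨⟨z, hz'⟩, rfl⟩ := Submodule.mkQ_surjective _ z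
    exact Subtype.ext hz'

/-- The short complex `H → B ⧸ range f → range e`, where `H` is the homology at `B`. -/
abbrev homologyShortComplex (f : A →ₗ[R] B) (e : B →ₗ[R] C) (h : e ∘ₗ f = 0) :
    ShortComplex (ModuleCat.{u} R) :=
  ModuleCat.shortComplexOfCompEqZero (homologyToCoker f e) (cokerToRange f e h)
    (homologyToCoker_exact f e h).linearMap_comp_eq_zero

theorem homologyShortComplex_shortExact (f : A →ₗ[R] B) (e : B →ₗ[R] C) (h : e ∘ₗ f = 0) :
    (homologyShortComplex f e h).ShortExact :=
  ModuleCat.shortComplex_shortExact _ (homologyToCoker_exact f e h) (homologyToCoker_injective f e)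
    (cokerToRange_surjective f e h)

theorem subsingleton_ext_of_projective [Module.Projective R C] (Y : ModuleCat.{u} R) (n : ℕ) :
    Subsingleton (Ext (ModuleCat.of R C) Y (n + 1)) :=
  Ext.subsingleton_of_projective _ _ _

/-- The shift starts in degree one because a projective `C` may have nonzero `Ext` in degree zero.
-/
theorem nonempty_ext_range_linearEquiv [Module.Projective R C] (S : Submodule R C)
    (Y : ModuleCat.{u} R) (n : ℕ) :
    Nonempty (Ext (ModuleCat.of R S) Y (n + 1) ≃ₗ[R] Ext (ModuleCat.of R (C ⧸ S)) Y (n + 1 + 1)) := by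
  have h1 : Subsingleton (Ext (submoduleShortComplex S).X₂ Y (n + 1)) :=
    subsingleton_ext_of_projective Y n
  have h2 : Subsingleton (Ext (submoduleShortComplex S).X₂ Y (n + 1 + 1)) :=
    subsingleton_ext_of_projective Y (n + 1)
  exact nonempty_ext_linearEquiv_of_subsingleton_X₂ (submoduleShortComplex_shortExact S) Y (n + 1)

/-- Dimension shift along a complex with small homology. -/
theorem nonempty_ext_coker_linearEquiv [Module.Projective R C] (f : A →ₗ[R] B) (e : B →ₗ[R] C)
    (h : e ∘ₗ f = 0) (Y : ModuleCat.{u} R) (n : ℕ)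
    (h0 : Subsingleton (Ext (ModuleCat.of R (linearHomology f e)) Y n))
    (h1 : Subsingleton (Ext (ModuleCat.of R (linearHomology f e)) Y (n + 1))) :
    Nonempty (Ext (ModuleCat.of R (B ⧸ LinearMap.range f)) Y (n + 1) ≃ₗ[R]
      Ext (ModuleCat.of R (C ⧸ LinearMap.range e)) Y (n + 1 + 1)) := by
  have h0' : Subsingleton (Ext (homologyShortComplex f e h).X₁ Y n) := h0
  have h1' : Subsingleton (Ext (homologyShortComplex f e h).X₁ Y (n + 1)) := h1
  obtain ⟨e1⟩ := nonempty_ext_linearEquiv_of_subsingleton_X₁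
    (homologyShortComplex_shortExact f e h) Y n
  obtain ⟨e2⟩ := nonempty_ext_range_linearEquiv (LinearMap.range e) Y n
  exact ⟨e1.symm.trans e2⟩

/-- The last dimension shift, where the cokernel has small projective dimension. -/
theorem nonempty_ext_coker_linearEquiv_homology [Module.Projective R C] (f : A →ₗ[R] B)
    (e : B →ₗ[R] C) (h : e ∘ₗ f = 0) (Y : ModuleCat.{u} R) (n : ℕ)
    (h0 : Subsingleton (Ext (ModuleCat.of R (C ⧸ LinearMap.range e)) Y (n + 1 + 1)))
    (h1 : Subsingleton (Ext (ModuleCat.of R (C ⧸ LinearMap.range e)) Y (n + 1 + 1 + 1))) :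
    Nonempty (Ext (ModuleCat.of R (B ⧸ LinearMap.range f)) Y (n + 1) ≃ₗ[R]
      Ext (ModuleCat.of R (linearHomology f e)) Y (n + 1)) := by
  obtain ⟨e0⟩ := nonempty_ext_range_linearEquiv (LinearMap.range e) Y n
  obtain ⟨e1⟩ := nonempty_ext_range_linearEquiv (LinearMap.range e) Y (n + 1)
  have h0' : Subsingleton (Ext (homologyShortComplex f e h).X₃ Y (n + 1)) :=
    e0.injective.subsingleton
  have h1' : Subsingleton (Ext (homologyShortComplex f e h).X₃ Y (n + 1 + 1)) :=
    e1.injective.subsingleton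
  exact nonempty_ext_linearEquiv_of_subsingleton_X₃
    (homologyShortComplex_shortExact f e h) Y (n + 1)

/-- The connecting map `Hom(X₁, Y) → Ext¹(X₃, Y)`. -/
noncomputable def homToExtOne {S : ShortComplex (ModuleCat.{u} R)} (hS : S.ShortExact)
    (Y : ModuleCat.{u} R) : (S.X₁ →ₗ[R] Y) →ₗ[R] Ext S.X₃ Y 1 :=
  (hS.extClass.precompOfLinear R Y (add_zero 1)) ∘ₗ (extZeroLinearEquiv S.X₁ Y).symm.toLinearMap

theorem homToExtOne_surjective {S : ShortComplex (ModuleCat.{u} R)} (hS : S.ShortExact)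
    (Y : ModuleCat.{u} R) [Subsingleton (Ext S.X₂ Y 1)] :
    Function.Surjective (homToExtOne hS Y) := by
  intro x
  obtain ⟨z, hz⟩ := Ext.contravariant_sequence_exact₃ hS Y x (Subsingleton.elim _ _) (add_zero 1)
  refine ⟨extZeroLinearEquiv S.X₁ Y z, ?_⟩
  rw [homToExtOne, LinearMap.comp_apply, LinearEquiv.coe_coe, LinearEquiv.symm_apply_apply]
  exact hz

theorem extZeroLinearEquiv_symm_apply {X Y : ModuleCat.{u} R} (φ : X →ₗ[R] Y) :
    (extZeroLinearEquiv X Y).symm φ = Ext.mk₀ (ModuleCat.ofHom φ) := rfl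

theorem homToExtOne_eq_zero_iff {S : ShortComplex (ModuleCat.{u} R)} (hS : S.ShortExact)
    (Y : ModuleCat.{u} R) (φ : S.X₁ →ₗ[R] Y) :
    homToExtOne hS Y φ = 0 ↔ ∃ ψ : S.X₂ →ₗ[R] Y, ψ ∘ₗ S.f.hom = φ := by
  constructor
  · intro h
    obtain ⟨z, hz⟩ := Ext.contravariant_sequence_exact₁ hS Y _ (add_zero 1) h
    obtain ⟨ψ, rfl⟩ := (extZeroLinearEquiv S.X₂ Y).symm.surjective z
    refine ⟨ψ, (extZeroLinearEquiv S.X₁ Y).symm.injective ?_⟩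
    refine Eq.trans ?_ hz
    rw [extZeroLinearEquiv_symm_apply, extZeroLinearEquiv_symm_apply, Ext.mk₀_comp_mk₀]
    rfl
  · rintro ⟨ψ, rfl⟩
    have : (extZeroLinearEquiv S.X₁ Y).symm (ψ ∘ₗ S.f.hom) =
        (Ext.mk₀ S.f).comp ((extZeroLinearEquiv S.X₂ Y).symm ψ) (zero_add 0) := by
      rw [extZeroLinearEquiv_symm_apply, extZeroLinearEquiv_symm_apply, Ext.mk₀_comp_mk₀]
      rfl
    rw [homToExtOne, LinearMap.comp_apply, LinearEquiv.coe_coe, this]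
    exact hS.extClass_comp_assoc (h := add_zero 1) _

theorem exists_extension_of_subsingleton_ext_one {S : ShortComplex (ModuleCat.{u} R)}
    (hS : S.ShortExact) (Y : ModuleCat.{u} R) [Subsingleton (Ext S.X₃ Y 1)] (φ : S.X₁ →ₗ[R] Y) :
    ∃ ψ : S.X₂ →ₗ[R] Y, ψ ∘ₗ S.f.hom = φ :=
  (homToExtOne_eq_zero_iff hS Y φ).mp (Subsingleton.elim _ _)

/-- A linear map vanishing on the kernel of `e` factors through the image of `e`. -/
theorem exists_comp_rangeRestrict_eq {Y : Type*} [AddCommGroup Y] [Module R Y] (e : B →ₗ[R] C)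
    (φ : B →ₗ[R] Y) (hφ : ∀ b, e b = 0 → φ b = 0) :
    ∃ ψ : LinearMap.range e →ₗ[R] Y, ψ ∘ₗ e.rangeRestrict = φ := by
  refine ⟨(LinearMap.ker e).liftQ φ (fun b hb => hφ b hb) ∘ₗ
    e.quotKerEquivRange.symm.toLinearMap, ?_⟩
  ext b
  have : e.quotKerEquivRange.symm (e.rangeRestrict b) = Submodule.Quotient.mk b := by
    rw [LinearEquiv.symm_apply_eq]
    rfl
  rw [LinearMap.comp_apply, LinearMap.comp_apply, LinearEquiv.coe_coe, this]
  rfl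

theorem nonempty_linearHomology_linearEquiv_of_surjective {E : Type*} [AddCommGroup E] [Module R E]
    (f : A →ₗ[R] B) (e : B →ₗ[R] C) (p : LinearMap.ker e →ₗ[R] E) (hp : Function.Surjective p)
    (hk : ∀ x : LinearMap.ker e, p x = 0 ↔ (x : B) ∈ LinearMap.range f) :
    Nonempty (linearHomology f e ≃ₗ[R] E) := by
  refine ⟨(Submodule.quotEquivOfEq _ _ ?_).trans (p.quotKerEquivOfSurjective hp)⟩
  ext x
  rw [LinearMap.mem_ker, hk]
  rfl

/-- If `Hom(H, Y) = 0`, then the cohomology of `Hom(-, Y)` is `Ext¹` of the next cokernel. -/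
theorem nonempty_linearHomology_lcomp_linearEquiv_ext_one [Module.Projective R C] (f : A →ₗ[R] B)
    (e : B →ₗ[R] C) (h : e ∘ₗ f = 0) (Y : ModuleCat.{u} R)
    [Subsingleton (linearHomology f e →ₗ[R] Y)] :
    Nonempty (linearHomology (e.lcomp R Y) (f.lcomp R Y) ≃ₗ[R]
      Ext (ModuleCat.of R (C ⧸ LinearMap.range e)) Y 1) := by
  have hS := submoduleShortComplex_shortExact (LinearMap.range e)
  have : Subsingleton (Ext (submoduleShortComplex (LinearMap.range e)).X₂ Y 1) :=
    subsingleton_ext_of_projective Y 0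
  -- As `Hom(H, Y) = 0`, every cocycle vanishes on `ker e`, so cocycles are the maps on `range e`.
  -- The coboundaries among them are those that extend to `C`, and the obstruction to extending is
  -- the class in `Ext¹`.
  let q : (LinearMap.range e →ₗ[R] Y) →ₗ[R] LinearMap.ker (f.lcomp R Y) :=
    LinearMap.codRestrict _ (e.rangeRestrict.lcomp R Y) fun ψ => by
      ext a
      change ψ (e.rangeRestrict (f a)) = 0
      rw [show e.rangeRestrict (f a) = 0 from Subtype.ext (LinearMap.congr_fun h a), map_zero]
  have hq : Function.Bijective q := by
    constructor
    · intro ψ ψ' hψ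
      ext ⟨_, b, rfl⟩
      exact LinearMap.congr_fun (congrArg Subtype.val hψ) b
    · rintro ⟨φ, hφ⟩
      have hφ' : ∀ b, e b = 0 → φ b = 0 := fun b hb => by
        let θ : linearHomology f e →ₗ[R] Y :=
          Submodule.liftQ _ (φ ∘ₗ (LinearMap.ker e).subtype) (by
            rintro ⟨_, h⟩ ⟨a, rfl⟩
            exact LinearMap.congr_fun hφ a)
        exact LinearMap.congr_fun (Subsingleton.elim θ 0) (Submodule.Quotient.mk ⟨b, hb⟩)
      obtain ⟨ψ, hψ⟩ := exists_comp_rangeRestrict_eq e φ hφ'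
      exact ⟨ψ, Subtype.ext hψ⟩
  let Q := LinearEquiv.ofBijective q hq
  refine nonempty_linearHomology_linearEquiv_of_surjective _ _
    (homToExtOne hS Y ∘ₗ Q.symm.toLinearMap)
    ((homToExtOne_surjective hS Y).comp Q.symm.surjective) fun x => ?_
  obtain ⟨ψ, rfl⟩ := Q.surjective x
  rw [LinearMap.comp_apply, LinearEquiv.coe_coe, Q.symm_apply_apply]
  refine (homToExtOne_eq_zero_iff hS Y ψ).trans ?_
  constructor
  · rintro ⟨χ, rfl⟩
    exact ⟨χ, rfl⟩
  · rintro ⟨χ, hχ⟩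
    refine ⟨χ, ?_⟩
    ext ⟨_, b, rfl⟩
    exact LinearMap.congr_fun hχ b

/-- If `Ext¹` and `Ext²` of the next cokernel vanish, then `Hom(-, Y)` commutes with homology. -/
theorem nonempty_linearHomology_lcomp_linearEquiv_hom [Module.Projective R C] (f : A →ₗ[R] B)
    (e : B →ₗ[R] C) (h : e ∘ₗ f = 0) (Y : ModuleCat.{u} R)
    (h1 : Subsingleton (Ext (ModuleCat.of R (C ⧸ LinearMap.range e)) Y 1))
    (h2 : Subsingleton (Ext (ModuleCat.of R (C ⧸ LinearMap.range e)) Y 2)) :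
    Nonempty (linearHomology (e.lcomp R Y) (f.lcomp R Y) ≃ₗ[R] (linearHomology f e →ₗ[R] Y)) := by
  have hS := submoduleShortComplex_shortExact (LinearMap.range e)
  have hT := homologyShortComplex_shortExact f e h
  have h1' : Subsingleton (Ext (submoduleShortComplex (LinearMap.range e)).X₃ Y 1) := h1
  obtain ⟨e0⟩ := nonempty_ext_range_linearEquiv (LinearMap.range e) Y 0
  have h2' : Subsingleton (Ext (homologyShortComplex f e h).X₃ Y 1) :=
    e0.injective.subsingleton
  -- Restriction of cocycles to `ker e`. It is onto because the obstruction lies in `Ext¹(range e) ≅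
  -- Ext²(C/range e) = 0`; a cocycle in its kernel factors through `range e` and extends to `C`
  -- because `Ext¹(C/range e) = 0`.
  let p : LinearMap.ker (f.lcomp R Y) →ₗ[R] (linearHomology f e →ₗ[R] Y) :=
    { toFun φ := Submodule.liftQ _ (φ.1 ∘ₗ (LinearMap.ker e).subtype) (by
        rintro ⟨_, h⟩ ⟨a, rfl⟩
        exact LinearMap.congr_fun φ.2 a)
      map_add' φ φ' := by
        ext x
        rfl
      map_smul' r φ := by
        ext x
        rfl }
  refine nonempty_linearHomology_linearEquiv_of_surjective _ _ p (fun θ => ?_) fun φ => ?_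
  · obtain ⟨ψ, hψ⟩ := exists_extension_of_subsingleton_ext_one hT Y θ
    refine ⟨⟨ψ ∘ₗ (LinearMap.range f).mkQ, ?_⟩, ?_⟩
    · ext a
      change ψ (Submodule.Quotient.mk (f a)) = 0
      rw [(Submodule.Quotient.mk_eq_zero _).mpr (LinearMap.mem_range_self f a), map_zero]
    · rw [← hψ]
      ext x
      rfl
  · constructor
    · intro hφ
      obtain ⟨ψ, hψ⟩ := exists_comp_rangeRestrict_eq e φ.1 fun b hb =>
        LinearMap.congr_fun hφ (Submodule.Quotient.mk ⟨b, hb⟩)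
      obtain ⟨χ, hχ⟩ := exists_extension_of_subsingleton_ext_one hS Y ψ
      refine ⟨χ, ?_⟩
      rw [← hψ, ← hχ]
      rfl
    · rintro ⟨χ, hχ⟩
      ext ⟨b, hb⟩
      change φ.1 b = 0
      rw [← hχ]
      change χ (e b) = 0
      rw [LinearMap.mem_ker.mp hb, map_zero]

end DimensionShift

/-! ### The isomorphism of Koszul homology with `Ext`. -/

section KoszulExt

open Abelian RingTheory.Sequence

variable {R : Type u} [CommRing R] {l : ℕ} (y : Fin l → R)

/-- Each step lowers the Koszul degree and raises the `Ext` degree by one. The step reaching `Ext`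
degree `t + 1` needs `Ext` of the homology to vanish in degrees `t - 1` and `t`, whence `t < g`. -/
theorem nonempty_ext_koszul_coker_linearEquiv (Y : ModuleCat.{u} R) (g : ℕ)
    (hv : ∀ (i j k : ℤ), j + 1 = i → k + 1 = j → ∀ n < g, Subsingleton
      (Ext (ModuleCat.of R (linearHomology (koszulD y R i j) (koszulD y R j k))) Y n))
    (t : ℕ) (ht : t < g) (j k : ℤ) (hk : k = j + t) :
    Nonempty (Ext (ModuleCat.of R
        (KoszulModule l R k ⧸ LinearMap.range (koszulD y R (k + 1) k))) Y 1 ≃ₗ[R]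
      Ext (ModuleCat.of R
        (KoszulModule l R j ⧸ LinearMap.range (koszulD y R (j + 1) j))) Y (t + 1)) := by
  induction t generalizing j with
  | zero =>
    obtain rfl : k = j := by simpa using hk
    exact ⟨LinearEquiv.refl R _⟩
  | succ t ih =>
    obtain ⟨e1⟩ := ih (by omega) (j + 1) (by push_cast at hk; omega)
    obtain ⟨e2⟩ := nonempty_ext_coker_linearEquiv (koszulD y R (j + 1 + 1) (j + 1))
      (koszulD y R (j + 1) j) (koszulD_comp y R _ _ _) Y t
      (hv _ _ _ rfl rfl t (by omega)) (hv _ _ _ rfl rfl (t + 1) ht)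
    exact ⟨e1.trans e2⟩

theorem nonempty_ext_congr_left {N N' : Type u} [AddCommGroup N] [Module R N] [AddCommGroup N']
    [Module R N'] (e : N ≃ₗ[R] N') (Y : ModuleCat.{u} R) (n : ℕ) :
    Nonempty (Ext (ModuleCat.of R N) Y n ≃ₗ[R] Ext (ModuleCat.of R N') Y n) := by
  have h1 : ModuleCat.ofHom e.symm.toLinearMap ≫ ModuleCat.ofHom e.toLinearMap = 𝟙 _ := by
    ext x
    exact e.apply_symm_apply x
  have h2 : ModuleCat.ofHom e.toLinearMap ≫ ModuleCat.ofHom e.symm.toLinearMap = 𝟙 _ := by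
    ext x
    exact e.symm_apply_apply x
  refine ⟨LinearEquiv.ofLinearMap
    ((Ext.mk₀ (ModuleCat.ofHom e.symm.toLinearMap)).precompOfLinear R Y (zero_add n))
    ((Ext.mk₀ (ModuleCat.ofHom e.toLinearMap)).precompOfLinear R Y (zero_add n)) ?_ ?_⟩
  · ext x
    simp [Ext.mk₀_comp_mk₀_assoc, h1]
  · ext x
    simp [Ext.mk₀_comp_mk₀_assoc, h2]

/-- If `R ⧸ I` has projective dimension at most `g` and `Ext` into `M` of every module annihilated
by `I` vanishes below `g`, then `H_{l-g-1}(y, M) ≅ Ext^g(H₁(y), M)`. -/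
theorem nonempty_koszulHomology_linearEquiv_ext (I : Ideal R)
    (hy : Ideal.span (Set.range y) = I) (M : Type u) [AddCommGroup M] [Module R M] (g : ℕ)
    [HasProjectiveDimensionLE (ModuleCat.of R (R ⧸ I)) g] (rs : List R) (hrs : ∀ r ∈ rs, r ∈ I)
    (hlen : rs.length = g) (hM : IsWeaklyRegular M rs) :
    Nonempty (koszulHomology y M ((l : ℤ) - g - 1) ≃ₗ[R]
      Ext (koszulHomology y R 1) (ModuleCat.of R M) g) := by
  let Y := ModuleCat.of R M
  have hv : ∀ (i j k : ℤ), j + 1 = i → k + 1 = j → ∀ n < g, Subsingleton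
      (Ext (ModuleCat.of R (linearHomology (koszulD y R i j) (koszulD y R j k))) Y n) :=
    fun i j k hij hjk n hn => subsingleton_ext_of_isWeaklyRegular rs n (hlen ▸ hn) Y
      (fun r hr => mem_annihilator_linearHomology_koszulD y R hij hjk (hy ▸ hrs r hr)) hM
  have hC : ∀ n, g < n → Subsingleton (Ext (ModuleCat.of R
      (KoszulModule l R 0 ⧸ LinearMap.range (koszulD y R 1 0))) Y n) := fun n hn => by
    obtain ⟨e⟩ := nonempty_koszulModule_zero_quotient_linearEquiv y I hy
    obtain ⟨e'⟩ := nonempty_ext_congr_left e Y n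
    have := HasProjectiveDimensionLT.subsingleton (ModuleCat.of R (R ⧸ I)) (g + 1) n hn Y
    exact e'.injective.subsingleton
  obtain ⟨e1⟩ := nonempty_koszulHomology_linearEquiv_dual y M (a := (l : ℤ) - g - 1)
    (j := (g : ℤ) + 1) (k := g) (by ring) rfl rfl
  obtain ⟨h1⟩ := nonempty_koszulHomology_linearEquiv y R (i := 2) (j := 1) (k := 0) rfl rfl
  obtain ⟨e2⟩ := nonempty_ext_congr_left h1 Y g
  have hcomp := koszulD_comp y R 2 1 0
  suffices h : Nonempty (linearHomology ((koszulD y R ((g : ℤ) + 1) g).lcomp R M)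
      ((koszulD y R ((g : ℤ) + 1 + 1) ((g : ℤ) + 1)).lcomp R M) ≃ₗ[R]
      Ext (ModuleCat.of R (linearHomology (koszulD y R 2 1) (koszulD y R 1 0))) Y g) by
    obtain ⟨e3⟩ := h
    exact ⟨(e1.trans e3).trans e2.symm⟩
  -- In grade zero `R/I` is projective and `Hom(-, M)` commutes with homology at `K_1`. In positive
  -- grade `Hom` from the homology to `M` is zero, which gives access to `Ext¹` of a cokernel.
  rcases g with _ | g
  · obtain ⟨e3⟩ := nonempty_linearHomology_lcomp_linearEquiv_hom (koszulD y R 2 1)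
      (koszulD y R 1 0) hcomp Y (hC 1 (by omega)) (hC 2 (by omega))
    exact ⟨e3.trans (extZeroLinearEquiv (ModuleCat.of R _) Y).symm⟩
  · have hsub : Subsingleton (linearHomology (koszulD y R (((g + 1 : ℕ) : ℤ) + 1 + 1)
        (((g + 1 : ℕ) : ℤ) + 1)) (koszulD y R (((g + 1 : ℕ) : ℤ) + 1) ((g + 1 : ℕ) : ℤ))
        →ₗ[R] Y) := by
      have := hv _ _ _ (rfl : ((g + 1 : ℕ) : ℤ) + 1 + 1 = _) rfl 0 (by omega)
      exact (extZeroLinearEquiv (ModuleCat.of R _) Y).symm.injective.subsingleton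
    obtain ⟨e3⟩ := nonempty_linearHomology_lcomp_linearEquiv_ext_one
      (koszulD y R (((g + 1 : ℕ) : ℤ) + 1 + 1) (((g + 1 : ℕ) : ℤ) + 1))
      (koszulD y R (((g + 1 : ℕ) : ℤ) + 1) ((g + 1 : ℕ) : ℤ)) (koszulD_comp y R _ _ _) Y
    -- The grade is now `g + 1`: `g` shifts lead from `C_{g+1}` to `C_1`, and the projective
    -- dimension of `R/I` then replaces `C_1` by `H_1`.
    obtain ⟨e4⟩ := nonempty_ext_koszul_coker_linearEquiv y Y (g + 1) hv g (by omega) 1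
      ((g + 1 : ℕ) : ℤ) (by push_cast; ring)
    obtain ⟨e5⟩ := nonempty_ext_coker_linearEquiv_homology (koszulD y R 2 1) (koszulD y R 1 0)
      hcomp Y g (hC _ (by omega)) (hC _ (by omega))
    exact ⟨(e3.trans e4).trans e5⟩

end KoszulExt

/-! ### Depth, heights and extension of regular sequences. -/

section GradeDepth

open Abelian RingTheory.Sequence Pointwise IsLocalRing

theorem le_gradeOn_of_isWeaklyRegular {R : Type*} [CommRing R] {I : Ideal R} {M : Type*}
    [AddCommGroup M] [Module R M] {rs : List R} (hrs : ∀ r ∈ rs, r ∈ I)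
    (hM : IsWeaklyRegular M rs) : (rs.length : ℕ∞) ≤ gradeOn I M :=
  le_iSup₂ (f := fun (rs : List R) (_ : (∀ r ∈ rs, r ∈ I) ∧ IsWeaklyRegular M rs) =>
    (rs.length : ℕ∞)) rs ⟨hrs, hM⟩

theorem exists_isWeaklyRegular_of_le_gradeOn {R : Type*} [CommRing R] {I : Ideal R} {M : Type*}
    [AddCommGroup M] [Module R M] {n : ℕ} (hn : (n : ℕ∞) ≤ gradeOn I M) :
    ∃ rs : List R, rs.length = n ∧ (∀ r ∈ rs, r ∈ I) ∧ IsWeaklyRegular M rs := by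
  suffices h : ∃ rs : List R, n ≤ rs.length ∧ (∀ r ∈ rs, r ∈ I) ∧ IsWeaklyRegular M rs by
    obtain ⟨rs, hlen, hrs, hM⟩ := h
    rw [← List.take_append_drop n rs, isWeaklyRegular_append_iff] at hM
    exact ⟨rs.take n, by simpa using hlen, fun r hr => hrs r (List.mem_of_mem_take hr), hM.1⟩
  rcases n with _ | n
  · exact ⟨[], le_rfl, by simp, IsWeaklyRegular.nil _ _⟩
  · by_contra! h
    have hle : gradeOn I M ≤ (n : ℕ∞) := iSup₂_le fun rs hrs => by
      have h1 : ¬ (n + 1 ≤ rs.length) := fun hlen => h rs hlen hrs.1 hrs.2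
      exact_mod_cast (show rs.length ≤ n by omega)
    have := hn.trans hle
    norm_cast at this
    omega

variable {R : Type u} [CommRing R]

/-- If `x` is `L`-regular, then an associated prime of `L` lies in an associated prime of
`L ⧸ x L` containing `x`. -/
theorem exists_associatedPrime_quotSMulTop [IsLocalRing R] [IsNoetherianRing R] (L : Type u)
    [AddCommGroup L] [Module R L] [Module.Finite R L] {x : R} (hx : x ∈ maximalIdeal R)
    (hreg : IsSMulRegular L x) {q : Ideal R} (hq : IsAssociatedPrime q L) :
    ∃ q' : Ideal R, IsAssociatedPrime q' (QuotSMulTop x L) ∧ q ≤ q' ∧ x ∈ q' := by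
  obtain ⟨-, z₀, hz₀⟩ := isAssociatedPrime_iff.mp hq
  have hz₀0 : z₀ ≠ 0 := by
    rintro rfl
    exact hq.isPrime.ne_top (by rw [hz₀]; ext; simp [Submodule.mem_colon_singleton])
  let U : Submodule R L := Submodule.torsionBySet R L q
  have hU : ∀ z, z ∈ U ↔ ∀ r ∈ q, r • z = 0 := fun z => by
    simp [U, Submodule.mem_torsionBySet_iff]
  have hzU : z₀ ∈ U := by
    rw [hU]
    intro r hr
    rw [hz₀, Submodule.mem_colon_singleton] at hr
    simpa using hr
  -- If `U ⊆ xL`, regularity of `x` gives `U = xU`, and Nakayama contradicts `z₀ ≠ 0`. An element of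
  -- `U` outside `xL` then has a nonzero class in `L/xL` killed by `q` and by `x`.
  have hne : ¬ U ≤ x • (⊤ : Submodule R L) := by
    intro hle
    have hbot : U = ⊥ := by
      refine Submodule.eq_bot_of_le_smul_of_le_jacobson_bot (Ideal.span {x}) U
        (IsNoetherian.noetherian _) ?_ ?_
      · intro z hz
        obtain ⟨w, -, rfl⟩ := (Submodule.mem_smul_pointwise_iff_exists _ _ _).mp (hle hz)
        refine Submodule.smul_mem_smul (Ideal.mem_span_singleton_self x) ?_
        rw [hU] at hz ⊢
        intro r hr
        apply hreg.right_eq_zero_of_smul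
        rw [smul_comm, hz r hr]
      · rw [Ideal.span_singleton_le_iff_mem, jacobson_eq_maximalIdeal _ bot_ne_top]
        exact hx
    rw [hbot, Submodule.mem_bot] at hzU
    exact hz₀0 hzU
  obtain ⟨z, hz, hzx⟩ := Set.not_subset.mp hne
  have hz' : (Submodule.Quotient.mk z : QuotSMulTop x L) ≠ 0 := by
    rwa [Ne, Submodule.Quotient.mk_eq_zero]
  obtain ⟨q', hq', hle⟩ := exists_le_isAssociatedPrime_of_isNoetherianRing R
    (Submodule.Quotient.mk z : QuotSMulTop x L) hz'
  have hmem : ∀ r : R, r • z ∈ x • (⊤ : Submodule R L) → r ∈ q' := fun r hr => by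
    apply hle
    rw [Submodule.mem_colon_singleton, ← Submodule.Quotient.mk_smul]
    exact (Submodule.Quotient.mk_eq_zero _).mpr hr
  refine ⟨q', hq', fun r hr => hmem r ?_, hmem x ?_⟩
  · rw [(hU z).mp hz r hr]
    exact Submodule.zero_mem _
  · exact Submodule.smul_mem_pointwise_smul z x ⊤ trivial

/-- Measured by vanishing of `Ext`, depth drops by at most one modulo any regular element of the
annihilator, so different regular sequences need not be compared. -/
theorem subsingleton_ext_quotSMulTop {N M : ModuleCat.{u} R} {r : R}
    (hr : r ∈ Module.annihilator R N) (hM : IsSMulRegular M r) {n : ℕ}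
    (h : ∀ i < n + 1, Subsingleton (Ext N M i)) :
    ∀ i < n, Subsingleton (Ext N (ModuleCat.of R (QuotSMulTop r M)) i) := fun i hi => by
  have := h i (by omega)
  have := h (i + 1) (by omega)
  obtain ⟨e⟩ := nonempty_ext_linearEquiv_quotSMulTop hr hM i
  exact e.injective.subsingleton

variable [IsLocalRing R]

theorem annihilator_quotient_maximalIdeal :
    Module.annihilator R (ModuleCat.of R (R ⧸ maximalIdeal R)) = maximalIdeal R :=
  Ideal.annihilator_quotient

variable [IsNoetherianRing R]

/-- The depth of `L`, measured by `Ext`, is at most the dimension of `R ⧸ q` for every associated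
prime `q`. -/
theorem le_coheight_of_isAssociatedPrime (n : ℕ) (L : ModuleCat.{u} R) [Module.Finite R L]
    (h : ∀ i < n, Subsingleton (Ext (ModuleCat.of R (R ⧸ maximalIdeal R)) L i))
    (q : PrimeSpectrum R) (hq : IsAssociatedPrime q.asIdeal L) : (n : ℕ∞) ≤ Order.coheight q := by
  induction n generalizing L q with
  | zero => simp
  | succ n ih =>
    have h0 := h 0 (by omega)
    have h0' : Subsingleton (R ⧸ maximalIdeal R →ₗ[R] L) :=
      (extZeroLinearEquiv (ModuleCat.of R (R ⧸ maximalIdeal R)) L).symm.injective.subsingleton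
    obtain ⟨x, hx, hreg⟩ := IsSMulRegular.subsingleton_linearMap_iff.mp h0'
    have hx' : x ∈ maximalIdeal R := by rwa [Ideal.annihilator_quotient] at hx
    obtain ⟨q', hq', hle, hxq⟩ := exists_associatedPrime_quotSMulTop L hx' hreg hq
    have hn := ih (ModuleCat.of R (QuotSMulTop x L)) (subsingleton_ext_quotSMulTop hx hreg h)
      ⟨q', hq'.isPrime⟩ hq'
    have hxq0 : x ∉ q.asIdeal := by
      intro hxq0
      obtain ⟨-, z, hz⟩ := isAssociatedPrime_iff.mp hq
      rw [hz, Submodule.mem_colon_singleton, Submodule.mem_bot] at hxq0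
      have hz0 := hreg.right_eq_zero_of_smul hxq0
      exact hq.isPrime.ne_top (by rw [hz, hz0]; ext; simp [Submodule.mem_colon_singleton])
    -- The regular element `x` lies in `q'` but not in the associated prime `q`, so every cut
    -- lengthens a chain of primes above `q`.
    have hlt : q < (⟨q', hq'.isPrime⟩ : PrimeSpectrum R) := by
      refine lt_of_le_of_ne hle fun heq => hxq0 ?_
      rw [heq]
      exact hxq
    push_cast
    exact (add_le_add_left hn 1).trans (Order.coheight_add_one_le hlt)

/-- A module whose depth is large compared to the dimensions of `R ⧸ q`, `J ≤ q`, has a regular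
sequence in `J`. -/
theorem exists_isWeaklyRegular_of_coheight_add_le (J : Ideal R) (hJ : J ≤ maximalIdeal R)
    (t n : ℕ) (M : ModuleCat.{u} R) [Module.Finite R M]
    (h : ∀ i < n, Subsingleton (Ext (ModuleCat.of R (R ⧸ maximalIdeal R)) M i))
    (hn : ∀ q : PrimeSpectrum R, J ≤ q.asIdeal → Order.coheight q + t ≤ n) :
    ∃ us : List R, us.length = t ∧ (∀ u ∈ us, u ∈ J) ∧ IsWeaklyRegular M us := by
  induction t generalizing M n with
  | zero => exact ⟨[], rfl, by simp, IsWeaklyRegular.nil _ _⟩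
  | succ t ih =>
    have hx : ∃ x ∈ J, IsSMulRegular M x := by
      -- Otherwise prime avoidance puts `J` inside an associated prime `q` of `M`, whose coheight is
      -- at least `n`, against `coheight q + (t + 1) ≤ n`.
      by_contra! hno
      have hsub : (J : Set R) ⊆ ⋃ p ∈ associatedPrimes R M, (p : Set R) := by
        rw [biUnion_associatedPrimes_eq_compl_regular]
        exact fun r hr => hno r hr
      obtain ⟨q, hq, hle⟩ := (Ideal.subset_union_prime_finite (associatedPrimes.finite R M)
        (f := id) 0 0 fun _ h _ _ => h.isPrime).1 hsub
      have hq' : IsAssociatedPrime q M := hq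
      have h1 := le_coheight_of_isAssociatedPrime n M h ⟨q, hq'.isPrime⟩ hq'
      have h2 := (add_le_add_left h1 ((t + 1 : ℕ) : ℕ∞)).trans (hn ⟨q, hq'.isPrime⟩ hle)
      norm_cast at h2
      omega
    obtain ⟨x, hxJ, hreg⟩ := hx
    rcases n with _ | n
    · have h2 := hn ⟨maximalIdeal R, inferInstance⟩ hJ
      have h3 := (le_add_self : ((t + 1 : ℕ) : ℕ∞) ≤ _).trans h2
      norm_cast at h3
    · have hx' : x ∈ Module.annihilator R (ModuleCat.of R (R ⧸ maximalIdeal R)) := by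
        rw [annihilator_quotient_maximalIdeal]
        exact hJ hxJ
      obtain ⟨us, hlen, hus, hM⟩ := ih n (ModuleCat.of R (QuotSMulTop x M))
        (subsingleton_ext_quotSMulTop hx' hreg h) (fun q hq => by
          have := hn q hq
          push_cast at this
          rw [← add_assoc] at this
          exact (ENat.add_le_add_iff_right ENat.one_ne_top).mp this)
      refine ⟨x :: us, by simp [hlen], ?_, ?_⟩
      · rintro u (_ | ⟨_, hu⟩)
        exacts [hxJ, hus u hu]
      · exact (isWeaklyRegular_cons_iff _ _ _).mpr ⟨hreg, hM⟩

/-- Extension of a regular sequence inside an ideal. -/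
theorem exists_isWeaklyRegular_append (J : Ideal R) (hJ : J ≤ maximalIdeal R) (rs : List R)
    (hrs : ∀ r ∈ rs, r ∈ maximalIdeal R) (t n : ℕ) (M : ModuleCat.{u} R) [Module.Finite R M]
    (h : ∀ i < n, Subsingleton (Ext (ModuleCat.of R (R ⧸ maximalIdeal R)) M i))
    (hn : ∀ q : PrimeSpectrum R, J ≤ q.asIdeal →
      Order.coheight q + ((rs.length + t : ℕ) : ℕ∞) ≤ n)
    (hM : IsWeaklyRegular M rs) :
    ∃ us : List R, us.length = t ∧ (∀ u ∈ us, u ∈ J) ∧ IsWeaklyRegular M (rs ++ us) := by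
  induction rs generalizing M n with
  | nil => exact exists_isWeaklyRegular_of_coheight_add_le J hJ t n M h (by simpa using hn)
  | cons r rs ih =>
    rcases n with _ | n
    · have h2 := hn ⟨maximalIdeal R, inferInstance⟩ hJ
      have h3 := (le_add_self : (((r :: rs).length + t : ℕ) : ℕ∞) ≤ _).trans h2
      norm_cast at h3
      simp at h3
    · rw [isWeaklyRegular_cons_iff] at hM
      have hr : r ∈ Module.annihilator R (ModuleCat.of R (R ⧸ maximalIdeal R)) := by
        rw [annihilator_quotient_maximalIdeal]
        exact hrs r List.mem_cons_self
      obtain ⟨us, hlen, hus, hMus⟩ := ih (fun s hs => hrs s (List.mem_cons_of_mem _ hs)) n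
        (ModuleCat.of R (QuotSMulTop r M)) (subsingleton_ext_quotSMulTop hr hM.1 h)
        (fun q hq => by
          have := hn q hq
          rw [List.length_cons, show rs.length + 1 + t = rs.length + t + 1 by omega,
            Nat.cast_succ, ← add_assoc, Nat.cast_succ] at this
          exact (ENat.add_le_add_iff_right ENat.one_ne_top).mp this) hM.2
      exact ⟨us, hlen, hus, (isWeaklyRegular_cons_iff _ _ _).mpr ⟨hM.1, hMus⟩⟩

theorem exists_ringKrullDim_eq_natCast : ∃ d : ℕ, ringKrullDim R = d := by
  rw [← maximalIdeal_height_eq_ringKrullDim]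
  have := Ideal.height_ne_top (I := maximalIdeal R) Ideal.IsPrime.ne_top'
  obtain ⟨d, hd⟩ := ENat.ne_top_iff_exists.mp this
  exact ⟨d, by rw [← hd]; rfl⟩

omit [IsNoetherianRing R] in
theorem height_add_coheight_le {d : ℕ} (hd : ringKrullDim R = d) (q : PrimeSpectrum R) :
    Order.height q + Order.coheight q ≤ d := by
  have h : ringKrullDim R = ↑(⨆ a : PrimeSpectrum R, Order.height a + Order.coheight a) :=
    Order.krullDim_eq_iSup_height_add_coheight_of_nonempty
  rw [hd] at h
  have h' : (d : ℕ∞) = ⨆ a : PrimeSpectrum R, Order.height a + Order.coheight a :=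
    WithBot.coe_injective h
  rw [h']
  exact le_iSup (fun a : PrimeSpectrum R => Order.height a + Order.coheight a) q

/-- In a maximal Cohen–Macaulay module, a regular sequence inside `J` can be extended inside `J`
up to the height of `J`. -/
theorem IsMaximalCohenMacaulay.exists_isWeaklyRegular_append {M : Type u} [AddCommGroup M]
    [Module R M] (hM : IsMaximalCohenMacaulay R M) (J : Ideal R) (hJ : J ≤ maximalIdeal R)
    (rs : List R) (hrs : ∀ r ∈ rs, r ∈ maximalIdeal R) (hreg : IsWeaklyRegular M rs) (t : ℕ)
    (ht : ∀ q : PrimeSpectrum R, J ≤ q.asIdeal → ((rs.length + t : ℕ) : ℕ∞) ≤ Order.height q) :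
    ∃ us : List R, us.length = t ∧ (∀ u ∈ us, u ∈ J) ∧ IsWeaklyRegular M (rs ++ us) := by
  have := hM.finite
  obtain ⟨d, hd⟩ := exists_ringKrullDim_eq_natCast (R := R)
  have hdepth : depth R M = d := by
    have := hM.depth_eq
    rw [hd] at this
    exact_mod_cast this
  obtain ⟨xs, hlen, hxs, hMxs⟩ := exists_isWeaklyRegular_of_le_gradeOn (n := d) hdepth.ge
  -- The depth of `M` is `d = dim R`, so `height q + coheight q ≤ d` turns the lower bound on
  -- heights into the required bound on coheights.
  refine KoszulHom.exists_isWeaklyRegular_append J hJ rs hrs t d (ModuleCat.of R M)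
    (fun i hi => subsingleton_ext_of_isWeaklyRegular xs i (hlen ▸ hi) _ (fun r hr => ?_) hMxs)
    (fun q hq => ?_) hreg
  · rw [annihilator_quotient_maximalIdeal]
    exact hxs r hr
  · rw [add_comm]
    exact (add_le_add_left (ht q hq) _).trans (height_add_coheight_le hd q)

omit [IsLocalRing R] in
/-- A regular sequence in `I` bounds the codimension of `I` at every prime containing `I`. -/
theorem ringKrullDim_quotient_map_add_length_le (I : Ideal R) (rs : List R)
    (hrs : ∀ r ∈ rs, r ∈ I) (hreg : IsWeaklyRegular R rs) (p : PrimeSpectrum R)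
    (hp : I ≤ p.asIdeal) :
    ringKrullDim (Localization.AtPrime p.asIdeal ⧸
      I.map (algebraMap R (Localization.AtPrime p.asIdeal))) + rs.length ≤
        (Order.height p : WithBot ℕ∞) := by
  -- `rs` stays regular in `R_p`, so `R_p/(rs)` has dimension `height p - rs.length`, and `R_p/I
  -- R_p` is a quotient of it.
  have hreg' := hreg.isRegular_of_isLocalization_of_mem (Localization.AtPrime p.asIdeal) p.asIdeal
    (fun r hr => hp (hrs r hr))
  have h1 := ringKrullDim_add_length_eq_ringKrullDim_of_isRegular _ hreg'
  rw [IsLocalization.AtPrime.ringKrullDim_eq_height p.asIdeal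
    (Localization.AtPrime p.asIdeal), PrimeSpectrum.height_eq_orderHeight,
    List.length_map] at h1
  rw [← h1]
  gcongr
  refine ringKrullDim_le_of_surjective (Ideal.Quotient.factor ?_)
    (Ideal.Quotient.factor_surjective _)
  refine Ideal.span_le.mpr ?_
  intro r hr
  obtain ⟨s, hs, rfl⟩ := List.mem_map.mp hr
  exact Ideal.mem_map_of_mem _ (hrs s hs)

omit [IsLocalRing R] in
theorem length_le_height (I : Ideal R) (rs : List R)
    (hrs : ∀ r ∈ rs, r ∈ I) (hreg : IsWeaklyRegular R rs) (p : PrimeSpectrum R)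
    (hp : I ≤ p.asIdeal) : (rs.length : ℕ∞) ≤ Order.height p := by
  have h := ringKrullDim_quotient_map_add_length_le I rs hrs hreg p hp
  have hnt : Nontrivial (Localization.AtPrime p.asIdeal ⧸
      I.map (algebraMap R (Localization.AtPrime p.asIdeal))) := by
    refine Ideal.Quotient.nontrivial_iff.mpr fun htop => ?_
    have hle : I.map (algebraMap R (Localization.AtPrime p.asIdeal)) ≤ maximalIdeal _ := by
      rw [← Localization.AtPrime.map_eq_maximalIdeal]
      exact Ideal.map_mono hp
    rw [htop, top_le_iff] at hle
    exact Ideal.IsPrime.ne_top' hle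
  have h0 := ringKrullDim_nonneg_of_nontrivial (R := Localization.AtPrime p.asIdeal ⧸
      I.map (algebraMap R (Localization.AtPrime p.asIdeal)))
  have h1 := (le_add_of_nonneg_left h0).trans h
  exact_mod_cast h1

end GradeDepth

/-! ### Serre's condition and the comparison of its two forms. -/

section Serre

open RingTheory.Sequence

variable {R : Type u} [CommRing R]

theorem le_depthAt_of_isWeaklyRegular (p : PrimeSpectrum R) {N : Type u} [AddCommGroup N]
    [Module R N] {us : List R} (hus : ∀ u ∈ us, u ∈ p.asIdeal) (hN : IsWeaklyRegular N us) :
    (us.length : ℕ∞) ≤ depthAt p N := by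
  have h := hN.of_isLocalizedModule (Localization.AtPrime p.asIdeal) p.asIdeal.primeCompl
    (LocalizedModule.mkLinearMap p.asIdeal.primeCompl N)
  rw [← List.length_map (as := us) (algebraMap R (Localization.AtPrime p.asIdeal))]
  refine le_gradeOn_of_isWeaklyRegular (fun r hr => ?_) h
  obtain ⟨s, hs, rfl⟩ := List.mem_map.mp hr
  exact (IsLocalization.AtPrime.to_map_mem_maximal_iff _ p.asIdeal s).mpr (hus s hs)

/-- For a finite module annihilated by `I`, Serre's condition over `R ⧸ I` implies the one over
`R`. -/
theorem serreCondition_of_serreConditionOver (I : Ideal R) (k : ℕ) (N : Type u) [AddCommGroup N]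
    [Module R N] [Module.Finite R N] (hI : I ≤ Module.annihilator R N)
    (h : SerreConditionOver I k N) : SerreCondition R k N := by
  intro p
  by_cases hp : I ≤ p.asIdeal
  · refine (min_le_min_left _ ?_).trans (h p hp)
    rw [Module.supportDim_eq_ringKrullDim_quotient_annihilator]
    refine ringKrullDim_le_of_surjective (Ideal.Quotient.factor ?_)
      (Ideal.Quotient.factor_surjective _)
    refine Ideal.map_le_iff_le_comap.mpr fun r hr => ?_
    rw [Ideal.mem_comap, Module.mem_annihilator]
    intro x
    rw [algebraMap_smul]
    induction x using LocalizedModule.induction_on with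
    | h m s => rw [LocalizedModule.smul'_mk, Module.mem_annihilator.mp (hI hr) m,
        LocalizedModule.zero_mk]
  -- Off the primes containing `I` the localization is zero, of dimension `⊥`.
  · obtain ⟨r, hr, hrp⟩ := Set.not_subset.mp hp
    have : Subsingleton (LocalizedModule p.asIdeal.primeCompl N) :=
      LocalizedModule.subsingleton_iff.mpr fun m =>
        ⟨r, hrp, Module.mem_annihilator.mp (hI hr) m⟩
    rw [Module.supportDim_eq_bot_of_subsingleton]
    exact (min_le_right _ _).trans bot_le

end Serre

theorem finite_koszulHomology {R : Type u} [CommRing R] [IsNoetherianRing R] {l : ℕ}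
    (y : Fin l → R) (M : Type u) [AddCommGroup M] [Module R M] [Module.Finite R M] (j : ℤ) :
    Module.Finite R (koszulHomology y M j) := by
  obtain ⟨e⟩ := nonempty_koszulHomology_linearEquiv y M (j := j) rfl (sub_add_cancel j 1)
  exact Module.Finite.equiv e.symm

end KoszulHom

/-! ### The theorem. -/

open KoszulHom in
theorem theorem1p2 {R : Type u} [CommRing R] [IsLocalRing R] (hR : IsCohenMacaulayLocal R)
    (I : Ideal R) (hI : IsPerfectIdeal I) (g : ℕ) (hg : gradeOn I R = g)
    (l : ℕ) (y : Fin l → R) (hy : Ideal.span (Set.range y) = I)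
    (M : Type u) [AddCommGroup M] [Module R M] (hM : IsMaximalCohenMacaulay R M) :
    Nonempty (koszulHomology y M ((l : ℤ) - g - 1) ≃ₗ[R]
        Abelian.Ext.{u} (koszulHomology y R 1) (ModuleCat.of R M) g) ∧
      SerreCondition R 2 (koszulHomology y M ((l : ℤ) - g - 1)) ∧
      SerreConditionOver I 2 (koszulHomology y M ((l : ℤ) - g - 1)) := by
  have := hR.isNoetherianRing
  have := hM.finite
  have hpd : projectiveDimension (ModuleCat.of R (R ⧸ I)) = g := by
    rw [hI, hg]
    rfl
  have hproj : HasProjectiveDimensionLE (ModuleCat.of R (R ⧸ I)) g :=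
    (projectiveDimension_le_iff _ g).mp hpd.le
  have hIm : I ≤ IsLocalRing.maximalIdeal R := by
    refine IsLocalRing.le_maximalIdeal ?_
    rintro rfl
    have : projectiveDimension (ModuleCat.of R (R ⧸ (⊤ : Ideal R))) = ⊥ := by
      rw [projectiveDimension_eq_bot_iff]
      exact ModuleCat.isZero_of_subsingleton _
    rw [this] at hpd
    exact absurd hpd.symm (WithBot.coe_ne_bot (a := (g : ℕ∞)))
  -- `xs` is regular on `R` and serves to bound heights of primes containing `I`; these bounds yield
  -- `rs`, of the same length `g` but regular on `M`.
  obtain ⟨xs, hxlen, hxs, hxreg⟩ := exists_isWeaklyRegular_of_le_gradeOn hg.ge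
  obtain ⟨rs, hlen, hrs, hreg⟩ := hM.exists_isWeaklyRegular_append I hIm [] (by simp)
    (RingTheory.Sequence.IsWeaklyRegular.nil R M) g (fun q hq => by
      rw [List.length_nil, zero_add, ← hxlen]
      exact length_le_height I xs hxs hxreg q hq)
  rw [List.nil_append] at hreg
  obtain ⟨e⟩ := nonempty_koszulHomology_linearEquiv_ext y I hy M g rs hrs hlen hreg
  have hover : SerreConditionOver I 2 (koszulHomology y M ((l : ℤ) - g - 1)) := by
    intro p hp
    have hdim := ringKrullDim_quotient_map_add_length_le I xs hxs hxreg p hp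
    set D := ringKrullDim (Localization.AtPrime p.asIdeal ⧸
      I.map (algebraMap R (Localization.AtPrime p.asIdeal))) with hD
    obtain hbot | ⟨t, ht⟩ : min ((2 : ℕ) : WithBot ℕ∞) D = ⊥ ∨
        ∃ t : ℕ, min ((2 : ℕ) : WithBot ℕ∞) D = t := by
      cases h : min ((2 : ℕ) : WithBot ℕ∞) D with
      | bot => exact Or.inl rfl
      | coe m =>
        right
        have hm : (m : WithBot ℕ∞) ≤ ((2 : ℕ) : ℕ∞) := h ▸ min_le_left _ _
        have hm' : m ≤ ((2 : ℕ) : ℕ∞) := WithBot.coe_le_coe.mp hm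
        obtain ⟨t, rfl⟩ := ENat.ne_top_iff_exists.mp
          (ne_top_of_le_ne_top (ENat.natCast_ne_top 2) hm')
        exact ⟨t, rfl⟩
    · rw [hbot]
      exact bot_le
    · have ht2 : t ≤ 2 := by
        have : (t : WithBot ℕ∞) ≤ ((2 : ℕ) : WithBot ℕ∞) := ht ▸ min_le_left _ _
        exact_mod_cast this
      have htD : (t : WithBot ℕ∞) ≤ D := ht ▸ min_le_right _ _
      -- Here `t = min(2, dim A_p)`, and `dim A_p + g ≤ height p`. This leaves room in `p` for `t`
      -- further elements after `rs`, which remain regular on `Ext^g` as `t ≤ 2`.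
      have hheight : ((rs.length + t : ℕ) : ℕ∞) ≤ Order.height p := by
        have h1 : (t : WithBot ℕ∞) + xs.length ≤ (Order.height p : WithBot ℕ∞) :=
          (add_le_add_left htD _).trans hdim
        rw [hlen, ← hxlen, add_comm]
        exact_mod_cast h1
      obtain ⟨us, hulen, hus, hureg⟩ := hM.exists_isWeaklyRegular_append p.asIdeal
        (IsLocalRing.le_maximalIdeal_of_isPrime _) rs (fun r hr => hIm (hrs r hr)) hreg t
        (fun q hq => hheight.trans (Order.height_mono hq))
      have hext := isWeaklyRegular_ext (N := koszulHomology y R 1) rs us (hulen ▸ ht2)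
        (ModuleCat.of R M)
        (fun r hr => mem_annihilator_koszulHomology y R 1 (hy ▸ hrs r hr)) hureg
      rw [hlen] at hext
      have hN := (e.isWeaklyRegular_congr us).mpr hext
      have := le_depthAt_of_isWeaklyRegular p hus hN
      rw [ht, ← hulen]
      exact_mod_cast this
  refine ⟨⟨e⟩, ?_, hover⟩
  have := finite_koszulHomology y M ((l : ℤ) - g - 1)
  exact serreCondition_of_serreConditionOver I 2 _
    (fun r hr => mem_annihilator_koszulHomology y M _ (hy ▸ hr)) hover
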